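/- Let $n,m\ge 1$ be integers, let $H$ be a complex Hilbert space and let $T=(T_1,\dots,T_n)\in L(H)^n$ be a commuting tuple of bounded operators. Denote also by $T:H^n\to H$, $(h_i)\mapsto\sum_{i=1}^n T_ih_i$, the induced row operator, by $T^*:H\to H^n$, $h\mapsto(T_i^*h)_i$, its adjoint, and by $W(T)=H\ominus\sum_{i=1}^nT_iH$ the wandering subspace of $T$, with orthogonal projection $P_{W(T)}$ from $H$ onto it. For $z\in\mathbb C^n$ let $Z:H^n\to H$, $(h_i)\mapsto\sum_i z_ih_i$. Assume: (a) $T$ is regular at $z=0$, that is, there is $\epsilon>0$ such that for all $z\in\mathbb C^n$ with Euclidean norm $\|z\|<\epsilon$ the space $(T-Z)H^n\subset H$ is closed and $H$ is the algebraic direct sum $H=(T-Z)H^n\oplus W(T)$. In particular $TH^n$ is closed, and $T^*T:\operatorname{Im}T^*\to\operatorname{Im}T^*$ is invertible; its inverse is denoted by $(T^*T)^{-1}$. (b) $(T^*T)^{-1}=(\oplus\Delta_T)|_{\operatorname{Im}T^*}$, where $\Delta_T=\sum_{j=0}^{m-1}(-1)^j\binom{m}{j+1}\sigma_T^j(1_H)\in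 L(H)$, $\sigma_T(X)=\sum_{i=1}^nT_iXT_i^*$, and $\oplus\Delta_T$ acts on $H^n$ componentwise. Let $L_1,\dots,L_n\in L(H)$ be the components of $L=(T^*T)^{-1}T^*\in L(H,H^n)$; by (b), $L_i=\Delta_TT_i^*$, and these operators commute. For $\alpha\in\mathbb N^n$ (where $0\in\mathbb N$) put $T^\alpha=T_1^{\alpha_1}\cdots T_n^{\alpha_n}$, $L^\alpha=L_1^{\alpha_1}\cdots L_n^{\alpha_n}$ and $\gamma_\alpha=|\alpha|!/\alpha!$. For a complex Hilbert space $\mathcal D$ let $H_m(\mathbb B,\mathcal D)$ be the $\mathcal D$-valued functional Hilbert space on the open Euclidean unit ball $\mathbb B\subset\mathbb C^n$ with reproducing kernel $K(z,w)=(1-\langle z,w\rangle)^{-m}\,1_{\mathcal D}$, and let $M_z=(M_{z_1},\dots,M_{z_n})\in L(H_m(\mathbb B,\mathcal D))^n$ be the tuple of multiplications by the coordinate functions. Then the following conditions on $T$ are equivalent: (i) $T$ is analytic, that is, $\bigcap_{k=0}^\infty\sum_{|\alpha|=k}T^\alpha H=\{0\}$; (ii) for every $x\in H$ the series $\sum_{\alpha\in\mathbb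 N^n}\gamma_\alpha(P_{W(T)}L^\alpha x)z^\alpha$ converges on $\mathbb B$ to a function in $H_m(\mathbb B,W(T))$, and $$\|x\|^2=\Big\|\sum_{\alpha\in\mathbb N^n}\gamma_\alpha(P_{W(T)}L^\alpha x)z^\alpha\Big\|^2_{H_m(\mathbb B,W(T))};$$ (iii) $T$ is of type $C_{\cdot0}$, that is, $\lim_{k\to\infty}\sigma_T^k(1_H)x=0$ for every $x\in H$; (iv) $T$ is unitarily equivalent to $M_z\in L(H_m(\mathbb B,\mathcal D))^n$ for some complex Hilbert space $\mathcal D$, that is, there is a unitary operator $U:H\to H_m(\mathbb B,\mathcal D)$ with $UT_i=M_{z_i}U$ for $i=1,\dots,n$. -/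

import Mathlib

universe u

noncomputable section

namespace BergmanShift

open Filter Topology ContinuousLinearMap

section Tuples

variable {n : ℕ} {H : Type*} [NormedAddCommGroup H] [InnerProductSpace ℂ H] [CompleteSpace H]

/-- The Hilbert space direct sum `H^n`. -/
abbrev HilbertPow (n : ℕ) (H : Type*) [NormedAddCommGroup H] := PiLp 2 (fun _ : Fin n => H)

/-- The row operator `H^n → H`, `(h_i) ↦ ∑ T_i h_i`, induced by a tuple `T ∈ L(H)^n`. -/
def rowOp (T : Fin n → H →L[ℂ] H) : HilbertPow n H →L[ℂ] H :=
  ∑ i, T i ∘L PiLp.proj 2 (fun _ : Fin n => H) i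

/-- The adjoint `T^* : H → H^n` of the row operator. -/
def colAdj (T : Fin n → H →L[ℂ] H) : H →L[ℂ] HilbertPow n H := adjoint (rowOp T)

/-- The adjoint of the row operator is the column operator `h ↦ (T_i^* h)_i`. -/
theorem colAdj_apply (T : Fin n → H →L[ℂ] H) (x : H) (i : Fin n) :
    colAdj T x i = adjoint (T i) x := by
  classical
  refine ext_inner_right ℂ fun y => ?_
  have h := adjoint_inner_left (rowOp T) (WithLp.toLp 2 (Pi.single i y)) x
  rw [PiLp.inner_apply] at h
  rw [Finset.sum_eq_single i (by intro j _ hj; simp [hj]) (by simp)] at h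
  rw [adjoint_inner_left]
  have h2 : rowOp T (WithLp.toLp 2 (Pi.single i y)) = T i y := by
    simp only [rowOp, sum_apply, comp_apply, PiLp.proj_apply]
    rw [Finset.sum_eq_single i (by intro j _ hj; simp [hj]) (by simp)]
    simp
  rw [h2] at h
  simpa [colAdj] using h

/-- The wandering subspace `W(T) = H ⊖ ∑ T_i H`. -/
def wandering (T : Fin n → H →L[ℂ] H) : Submodule ℂ H := (LinearMap.range (rowOp T).toLinearMap)ᗮ

instance (T : Fin n → H →L[ℂ] H) : CompleteSpace (wandering T) :=
  inferInstanceAs (CompleteSpace ↥(LinearMap.range (rowOp T).toLinearMap)ᗮ)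

/-- Regularity at `z = 0`: for all small `z ∈ ℂ^n` the space `(T - Z)H^n` is closed and `H` is the
algebraic direct sum of `(T - Z)H^n` and `W(T)`. -/
def IsRegularAtZero (T : Fin n → H →L[ℂ] H) : Prop :=
  ∃ ε : ℝ, 0 < ε ∧ ∀ z : EuclideanSpace ℂ (Fin n), ‖z‖ < ε →
    let R := LinearMap.range (rowOp fun i => T i - z i • (1 : H →L[ℂ] H)).toLinearMap
    IsClosed (R : Set H) ∧ IsCompl R (wandering T)

/-- The space `Im T^* ⊆ H^n`. -/
def imAdj (T : Fin n → H →L[ℂ] H) : Submodule ℂ (HilbertPow n H) :=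
  LinearMap.range (colAdj T).toLinearMap

/-- `T^* : H → Im T^*`. -/
def colAdjIm (T : Fin n → H →L[ℂ] H) : H →L[ℂ] imAdj T :=
  (colAdj T).codRestrict (imAdj T) fun x => ⟨x, rfl⟩

/-- The operator `T^* T : Im T^* → Im T^*`. -/
def gram (T : Fin n → H →L[ℂ] H) : imAdj T →L[ℂ] imAdj T :=
  colAdjIm T ∘L rowOp T ∘L (imAdj T).subtypeL

/-- The inverse `(T^* T)⁻¹ : Im T^* → Im T^*`. It is a genuine inverse as soon as `T H^n` is closed,
see `isInvertible_gram`. -/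
def gramInv (T : Fin n → H →L[ℂ] H) : imAdj T →L[ℂ] imAdj T :=
  ContinuousLinearMap.inverse (gram T)

/-- If `T H^n` is closed, then `T^* T : Im T^* → Im T^*` is invertible. -/
theorem isInvertible_gram (T : Fin n → H →L[ℂ] H)
    (hT : IsClosed (LinearMap.range (rowOp T).toLinearMap : Set H)) : (gram T).IsInvertible := by
  set A := rowOp T with hA
  set N : Submodule ℂ (HilbertPow n H) := (LinearMap.ker A.toLinearMap)ᗮ with hN
  set R : Submodule ℂ H := LinearMap.range A.toLinearMap with hR
  have cR : CompleteSpace R := hT.completeSpace_coe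
  have cK : CompleteSpace (LinearMap.ker A.toLinearMap) := A.isClosed_ker.completeSpace_coe
  let B : N →L[ℂ] R := (A ∘L N.subtypeL).codRestrict R fun x => ⟨x, rfl⟩
  have split : ∀ v : HilbertPow n H, ∃ v0 ∈ N, ∃ v1, A v1 = 0 ∧ v = v0 + v1 := fun v => by
    obtain ⟨y, hy, z, hz, h⟩ := Submodule.exists_add_mem_mem_orthogonal
      (K := LinearMap.ker A.toLinearMap) v
    exact ⟨z, hz, y, hy, by rw [h, add_comm]⟩
  have N0 : ∀ v ∈ N, A v = 0 → v = 0 := fun v hv h =>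
    inner_self_eq_zero (𝕜 := ℂ).1 (hv v h)
  have Binj : LinearMap.ker B.toLinearMap = ⊥ := by
    rw [LinearMap.ker_eq_bot']
    intro v hv
    exact Subtype.ext (N0 v v.2 (congrArg Subtype.val hv))
  have Bsurj : LinearMap.range B.toLinearMap = ⊤ := by
    rw [LinearMap.range_eq_top]
    rintro ⟨_, v, rfl⟩
    obtain ⟨v0, h0, v1, h1, rfl⟩ := split v
    refine ⟨⟨v0, h0⟩, Subtype.ext ?_⟩
    change A v0 = A (v0 + v1)
    rw [map_add, h1, add_zero]
  let e := ContinuousLinearEquiv.ofBijective B Binj Bsurj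
  have he : ∀ v, e v = B v := fun v => rfl
  have hNim : imAdj T = N := by
    apply le_antisymm
    · rintro _ ⟨x, rfl⟩ u hu
      have : A u = 0 := hu
      change inner ℂ u (adjoint A x) = 0
      rw [adjoint_inner_right, this, inner_zero_left]
    · intro y hy
      let x : R := adjoint (e.symm : R →L[ℂ] N) ⟨y, hy⟩
      refine ⟨x, ext_inner_right ℂ fun v => ?_⟩
      obtain ⟨v0, h0, v1, h1, rfl⟩ := split v
      change inner ℂ (adjoint A (x : H)) _ = _
      rw [adjoint_inner_left, map_add, h1, add_zero, inner_add_right]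
      have e1 : inner ℂ (x : H) (A v0) = inner ℂ x (e ⟨v0, h0⟩) := rfl
      have e2 : inner ℂ y v1 = 0 := by
        rw [← inner_conj_symm, hy v1 h1, map_zero]
      rw [e1, e2, add_zero, adjoint_inner_left]
      simp only [ContinuousLinearEquiv.coe_coe, ContinuousLinearEquiv.symm_apply_apply]
      rfl
  have cI : CompleteSpace (imAdj T) := by
    rw [hNim]; infer_instance
  have ginj : LinearMap.ker (gram T).toLinearMap = ⊥ := by
    rw [LinearMap.ker_eq_bot']
    intro v hv
    have h : adjoint A (A v) = 0 := congrArg Subtype.val hv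
    have h2 : A (v : HilbertPow n H) = 0 := by
      rw [← inner_self_eq_zero (𝕜 := ℂ), ← adjoint_inner_left, h, inner_zero_left]
    exact Subtype.ext (N0 v (hNim ▸ v.2) h2)
  have gsurj : LinearMap.range (gram T).toLinearMap = ⊤ := by
    rw [LinearMap.range_eq_top]
    rintro ⟨_, x, rfl⟩
    obtain ⟨_, ⟨v, rfl⟩, w, hw, rfl⟩ := Submodule.exists_add_mem_mem_orthogonal (K := R) x
    obtain ⟨v0, h0, v1, h1, rfl⟩ := split v
    refine ⟨⟨v0, hNim ▸ h0⟩, Subtype.ext ?_⟩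
    have hw0 : adjoint A w = 0 := ext_inner_left ℂ fun u => by
      rw [adjoint_inner_right, inner_zero_right]
      exact hw _ ⟨u, rfl⟩
    change adjoint A (A v0) = adjoint A (A (v0 + v1) + w)
    rw [map_add A, h1, add_zero, map_add, hw0, add_zero]
  exact ⟨ContinuousLinearEquiv.ofBijective (gram T) ginj gsurj, rfl⟩

/-- The components `L_i` of the column operator `L = (T^* T)⁻¹ T^* : H → H^n`. -/
def colL (T : Fin n → H →L[ℂ] H) (i : Fin n) : H →L[ℂ] H :=
  PiLp.proj 2 (fun _ : Fin n => H) i ∘L (imAdj T).subtypeL ∘L gramInv T ∘L colAdjIm T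

/-- `S^α = S_1^{α_1} ⋯ S_n^{α_n}` for a multi-index `α`. -/
def mpow (S : Fin n → H →L[ℂ] H) (α : Fin n → ℕ) : H →L[ℂ] H :=
  (List.ofFn fun i => S i ^ α i).prod

/-- `σ_T(X) = ∑ T_i X T_i^*`. -/
def sigma (T : Fin n → H →L[ℂ] H) (X : H →L[ℂ] H) : H →L[ℂ] H :=
  ∑ i, T i ∘L X ∘L adjoint (T i)

/-- `Δ_T = ∑_{j<m} (-1)^j (m choose (j+1)) σ_T^j(1_H)`. -/
def Delta (m : ℕ) (T : Fin n → H →L[ℂ] H) : H →L[ℂ] H :=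
  ∑ j ∈ Finset.range m, ((-1 : ℂ) ^ j * (m.choose (j + 1) : ℂ)) • ((sigma T)^[j] 1)

/-- The operator identity `(T^* T)⁻¹ = (⊕ Δ_T)|Im T^*`. -/
def SatisfiesIdentity (m : ℕ) (T : Fin n → H →L[ℂ] H) : Prop :=
  ∀ (y : imAdj T) (i : Fin n),
    (gramInv T y : HilbertPow n H) i = Delta m T ((y : HilbertPow n H) i)

/-- `T` is analytic: `⋂_k ∑_{|α|=k} T^α H = {0}` (the inner sum is the algebraic sum of finitely
many subspaces). -/
def IsAnalytic (T : Fin n → H →L[ℂ] H) : Prop :=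
  (⨅ k : ℕ, ⨆ (α : Fin n → ℕ) (_ : ∑ i, α i = k),
    LinearMap.range (mpow T α).toLinearMap : Submodule ℂ H) = ⊥

/-- `T` is of type `C_{·0}`: `σ_T^k(1_H) → 0` in the strong operator topology. -/
def IsTypeCDotZero (T : Fin n → H →L[ℂ] H) : Prop :=
  ∀ x : H, Tendsto (fun k : ℕ => ((sigma T)^[k] 1) x) atTop (𝓝 0)

/-- Componentwise unitary equivalence of two tuples. -/
def UnitarilyEquivalent {K : Type*} [NormedAddCommGroup K] [InnerProductSpace ℂ K]
    (T : Fin n → H →L[ℂ] H) (S : Fin n → K →L[ℂ] K) : Prop :=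
  ∃ U : H ≃ₗᵢ[ℂ] K, ∀ i x, U (T i x) = S i (U x)

end Tuples

section Space

/-- The open Euclidean unit ball of `ℂ^n`. -/
abbrev Ball (n : ℕ) : Type := Metric.ball (0 : EuclideanSpace ℂ (Fin n)) 1

variable (n m : ℕ) (E : Type*) [NormedAddCommGroup E] [InnerProductSpace ℂ E]

theorem re_sum_pow_nonneg (k : ℕ) (vv : Ball n →₀ E) :
    0 ≤ (vv.sum fun x w => vv.sum fun x' w' =>
      (inner ℂ x'.1 x.1) ^ k * (inner ℂ w w' : ℂ)).re := by
  have key : (vv.sum fun x w => vv.sum fun x' w' =>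
      (inner ℂ x'.1 x.1) ^ k * (inner ℂ w w' : ℂ)) =
      ∑ p ∈ Fintype.piFinset fun _ : Fin k => (Finset.univ : Finset (Fin n)),
        inner ℂ (vv.sum fun x w => (∏ j, (starRingEnd ℂ) (x.1 (p j))) • w)
          (vv.sum fun x w => (∏ j, (starRingEnd ℂ) (x.1 (p j))) • w) := by
    simp only [Finsupp.sum, sum_inner, inner_sum]
    rw [Finset.sum_comm]
    simp only [PiLp.inner_apply, Finset.sum_pow', Finset.sum_mul, inner_smul_left,
      inner_smul_right]
    rw [Finset.sum_comm (s := Fintype.piFinset _)]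
    refine Finset.sum_congr rfl fun x _ => ?_
    rw [Finset.sum_comm (s := Fintype.piFinset _)]
    refine Finset.sum_congr rfl fun y _ => Finset.sum_congr rfl fun p _ => ?_
    rw [← mul_assoc, map_prod, ← Finset.prod_mul_distrib]
    simp [mul_comm]
  rw [key, Complex.re_sum]
  exact Finset.sum_nonneg fun p _ => inner_self_nonneg (𝕜 := ℂ)

theorem inner_lt_one (x y : Ball n) : ‖(inner ℂ x.1 y.1 : ℂ)‖ < 1 := by
  have hx : ‖x.1‖ < 1 := mem_ball_zero_iff.1 x.2
  have hy : ‖y.1‖ < 1 := mem_ball_zero_iff.1 y.2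
  exact (norm_inner_le_norm _ _).trans_lt (mul_lt_one_of_nonneg_of_lt_one_left (norm_nonneg _) hx hy.le)

variable [CompleteSpace E]

/-- The kernel `K(z,w) = (1 - ⟨z,w⟩)^{-m} 1_E` on the ball, where `⟨z,w⟩ = ∑ z_i conj(w_i)`
(Mathlib's inner product is linear in its second argument). -/
def besovKernel : Matrix (Ball n) (Ball n) (E →L[ℂ] E) :=
  .of fun z w => ((1 - inner ℂ w.1 z.1) ^ m)⁻¹ • (1 : E →L[ℂ] E)

/-- The kernel is positive semidefinite. -/
theorem posSemidef_besovKernel : (besovKernel n m E).PosSemidef := by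
  have ht := RKHS.posSemidef_tfae (K := besovKernel n m E)
  have ht' := ht.out 0 2
  rw [ht']
  refine ⟨?_, fun vv => ?_⟩
  · ext x y v
    simp [besovKernel, Matrix.conjTranspose_apply, star_smul, star_inv₀]
  · have h : (vv.sum fun x w => vv.sum fun x' w' => inner ℂ ((besovKernel n m E x' x) w) w') =
        vv.sum fun x w => vv.sum fun x' w' =>
          ((1 - inner ℂ x'.1 x.1) ^ m)⁻¹ * (inner ℂ w w' : ℂ) := by
      simp [besovKernel, mul_comm]
    rw [h]
    rcases m with _ | m
    · simpa using re_sum_pow_nonneg n E 0 vv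
    have hs : HasSum (fun k : ℕ => ((k + m).choose m : ℂ) *
        (vv.sum fun x w => vv.sum fun x' w' => (inner ℂ x'.1 x.1) ^ k * (inner ℂ w w' : ℂ)))
        (vv.sum fun x w => vv.sum fun x' w' =>
          ((1 - inner ℂ x'.1 x.1) ^ (m + 1))⁻¹ * (inner ℂ w w' : ℂ)) := by
      simp only [Finsupp.sum, Finset.mul_sum]
      refine hasSum_sum fun x _ => hasSum_sum fun x' _ => ?_
      simp only [← mul_assoc]
      refine HasSum.mul_right _ ?_
      simpa using hasSum_choose_mul_geometric_of_norm_lt_one m (inner_lt_one n x' x)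
    refine (Complex.hasSum_re hs).nonneg fun k => ?_
    rw [show ((k + m).choose m : ℂ) = (((k + m).choose m : ℝ) : ℂ) by simp, Complex.re_ofReal_mul]
    exact mul_nonneg (by positivity) (re_sum_pow_nonneg n E k vv)

instance : Fact (besovKernel n m E).PosSemidef := ⟨posSemidef_besovKernel n m E⟩

/-- `H_m(𝔹, E)`: the functional Hilbert space of `E`-valued functions on the unit ball with
reproducing kernel `(1 - ⟨z,w⟩)^{-m} 1_E`. Its elements coerce to functions `Ball n → E`. -/
abbrev BesovSpace := RKHS.OfKernel (besovKernel n m E)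

variable {n m E}

/-- `M` is the tuple `M_z = (M_{z_1}, …, M_{z_n})` of multiplications by the coordinate functions. -/
def IsCoordMul (M : Fin n → BesovSpace n m E →L[ℂ] BesovSpace n m E) : Prop :=
  ∀ (i : Fin n) (f : BesovSpace n m E) (z : Ball n), M i f z = z.1 i • f z

/-- The function `f` is given on the ball by the (absolutely convergent) power series
`∑_α c_α z^α`. -/
def HasPowerSeries (f : BesovSpace n m E) (c : (Fin n → ℕ) → E) : Prop :=
  ∀ z : Ball n, HasSum (fun α : Fin n → ℕ => (∏ i, z.1 i ^ α i) • c α) (f z)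

end Space

end BergmanShift

end

noncomputable section

namespace BergmanShift

open Filter Topology ContinuousLinearMap

/-! ### The row operator, the wandering subspace and the left inverse `L` -/

section RowOperator

variable {n : ℕ} {H : Type*} [NormedAddCommGroup H] [InnerProductSpace ℂ H] [CompleteSpace H]

/-! Everything runs through the map `F(z)x = ∑_k P_W (∑ z_i L_i)^k x`. Regularity gives `F(z) T_i =
z_i F(z)` degree by degree (`taylorTerm_succ_row`), and the common kernel of the homogeneous terms
is exactly `⋂_k ∑_{|α|=k} T^α H` (`isAnalytic_iff`). So analyticity is injectivity of `x ↦ F(·)x`,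
and (ii) ⇒ (i) follows.

Hypothesis (b) gives `(1 - σ_T)^m(1) = P_W` (`one_sub_sigmaL_pow_one`). Hence the `m`-th backward
differences of `k ↦ ⟨σ_T^k(1)x, x⟩` are nonnegative.

(i) ⇒ (iii): put `t = ∑ conj(w_i) T_i` and take `e ∈ W`. Each `T_i^*` sends `t^(k+1) e` to a
multiple of `t^k e` (`exists_adjoint_eq_smul`), so `σ_T^N(1)` kills `t^k e` for `N > k`. Analyticity
makes these vectors total. On their span the moments are eventually zero, so nonnegative differences
make them decreasing; thus `σ_T^N(1)` is contractive and density finishes.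

(iii) ⇒ (ii), (iv): null moments allow the differences to be summed back, giving `x = ∑_k C(k+m-1,
m-1) σ_T^k(P_W) x`. This identifies the coefficients of `F` with multiples of `P_W T^{*α}`, bounds
them, and makes `F` converge on the ball. Moreover `F(w)^* e` is a joint eigenvector of the `T_i^*`,
and `(1 - σ_T)^m(1) = P_W` evaluated there yields `F(z)F(w)^* = K(z,w)` (`evalOp_adjoint_evalOp`).
So `F` is a unitary onto `H_m(𝔹, W)` carrying `T` to `M_z`.

(iv) ⇒ (iii): multiplying the kernel by `1 - ⟨z,w⟩` lowers its exponent by one and leaves it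
positive, so `σ_M(1) ≤ 1`; on kernel functions the moments decay geometrically. -/

omit [CompleteSpace H] in
theorem rowOp_apply (T : Fin n → H →L[ℂ] H) (h : HilbertPow n H) : rowOp T h = ∑ i, T i (h i) := by
  simp [rowOp, sum_apply]

theorem mem_wandering_iff {T : Fin n → H →L[ℂ] H} {x : H} :
    x ∈ wandering T ↔ ∀ i, adjoint (T i) x = 0 := by
  have h1 : x ∈ wandering T ↔ colAdj T x = 0 := by
    constructor
    · intro hx
      refine ext_inner_left ℂ fun v => ?_
      rw [colAdj, adjoint_inner_right, inner_zero_right]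
      exact hx _ ⟨v, rfl⟩
    · rintro hx _ ⟨v, rfl⟩
      change inner ℂ (rowOp T v) x = 0
      rw [← adjoint_inner_right]
      change inner ℂ v (colAdj T x) = 0
      rw [hx, inner_zero_right]
  rw [h1]
  constructor
  · intro h i
    rw [← colAdj_apply, h]
    rfl
  · intro h
    ext i
    rw [colAdj_apply, h i]
    rfl

/-- The orthogonal projection onto the wandering subspace. -/
def wanderingProj (T : Fin n → H →L[ℂ] H) : H →L[ℂ] wandering T :=
  (wandering T).orthogonalProjectionOnto

theorem wanderingProj_coe (T : Fin n → H →L[ℂ] H) (w : wandering T) : wanderingProj T w = w :=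
  Submodule.orthogonalProjectionOnto_mem_subspace_eq_self w

theorem inner_wanderingProj (T : Fin n → H →L[ℂ] H) (w : wandering T) (x : H) :
    inner ℂ w (wanderingProj T x) = inner ℂ (w : H) x :=
  Submodule.inner_orthogonalProjectionOnto_eq_of_mem_left w x

theorem wanderingProj_row (T : Fin n → H →L[ℂ] H) (i : Fin n) (x : H) :
    wanderingProj T (T i x) = 0 := by
  refine ext_inner_left ℂ fun w => ?_
  rw [inner_wanderingProj, ← adjoint_inner_left, mem_wandering_iff.1 w.2 i, inner_zero_left,
    inner_zero_right]

omit [CompleteSpace H] in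
theorem IsRegularAtZero.isClosed_range {T : Fin n → H →L[ℂ] H} (h : IsRegularAtZero T) :
    IsClosed (LinearMap.range (rowOp T).toLinearMap : Set H) := by
  obtain ⟨ε, hε, h⟩ := h
  have := (h 0 (by simpa using hε)).1
  simpa using this

variable {m : ℕ} {T : Fin n → H →L[ℂ] H}

theorem colL_apply_eq (hid : SatisfiesIdentity m T) (i : Fin n) (x : H) :
    colL T i x = Delta m T (adjoint (T i) x) := by
  have := hid (colAdjIm T x) i
  rw [← colAdj_apply]
  exact this

/-- The vector `v = Lx` solves the normal equation `T^*Tv = T^*x`, so `x - Tv` is orthogonal to the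
range and `TL` is the projection onto it. -/
theorem sum_row_colL (hT : IsClosed (LinearMap.range (rowOp T).toLinearMap : Set H)) (x : H) :
    ∑ i, T i (colL T i x) = x - wanderingProj T x := by
  set v : HilbertPow n H := (gramInv T (colAdjIm T x) : HilbertPow n H) with hv
  have h1 : rowOp T v = ∑ i, T i (colL T i x) := by
    rw [rowOp_apply]; rfl
  have h2 : colAdj T (rowOp T v) = colAdj T x := by
    have := (isInvertible_gram T hT).self_apply_inverse (colAdjIm T x)
    exact congrArg Subtype.val this
  have h3 : x - rowOp T v ∈ wandering T := by
    rw [mem_wandering_iff]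
    intro i
    rw [← colAdj_apply, map_sub, h2, sub_self]
    rfl
  have h4 : wanderingProj T x = ⟨x - rowOp T v, h3⟩ := by
    have : wanderingProj T x = wanderingProj T (x - rowOp T v) := by
      rw [map_sub, h1, map_sum]
      simp [wanderingProj_row]
    rw [this]
    exact wanderingProj_coe T ⟨x - rowOp T v, h3⟩
  rw [h4, ← h1]
  simp

theorem exists_colL_eq_adjoint (x : H) : ∃ y : H, ∀ i, colL T i x = adjoint (T i) y := by
  obtain ⟨y, hy⟩ := (gramInv T (colAdjIm T x)).2
  refine ⟨y, fun i => ?_⟩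
  rw [← colAdj_apply]
  exact (congrArg (fun v : HilbertPow n H => v i) hy).symm

/-- Since `Lx` lies in `Im T^*`, `L_j x = T_j^* y` with one `y` for all `j`; hence `L_i L_j x = Δ_T
T_i^* T_j^* y`, which is symmetric in `i` and `j`. -/
theorem colL_commute (hcomm : ∀ i j, T i * T j = T j * T i) (hid : SatisfiesIdentity m T)
    (i j : Fin n) : Commute (colL T i) (colL T j) := by
  have key : ∀ i j x, adjoint (T i) (adjoint (T j) x) = adjoint (T j) (adjoint (T i) x) := by
    intro i j x
    have := congrArg (fun A => adjoint A x) (hcomm j i)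
    simpa only [mul_def, adjoint_comp, comp_apply] using this
  ext x
  obtain ⟨y, hy⟩ := exists_colL_eq_adjoint (T := T) x
  change colL T i (colL T j x) = colL T j (colL T i x)
  rw [hy, hy, colL_apply_eq hid, colL_apply_eq hid, key]

theorem colL_wandering (hid : SatisfiesIdentity m T) (w : wandering T) (i : Fin n) :
    colL T i w = 0 := by
  rw [colL_apply_eq hid, mem_wandering_iff.1 w.2, map_zero]

end RowOperator

/-! ### The map `σ_T` and the operator form of hypothesis (b) -/

section Sigma

variable {n : ℕ} {H : Type*} [NormedAddCommGroup H] [InnerProductSpace ℂ H] [CompleteSpace H]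

/-- `σ_T` as a linear map on `L(H)`. -/
def sigmaL (T : Fin n → H →L[ℂ] H) : Module.End ℂ (H →L[ℂ] H) where
  toFun := sigma T
  map_add' X Y := by
    simp only [sigma, ← Finset.sum_add_distrib]
    refine Finset.sum_congr rfl fun i _ => ?_
    ext x; simp
  map_smul' c X := by
    simp only [sigma, Finset.smul_sum]
    refine Finset.sum_congr rfl fun i _ => ?_
    ext x; simp

theorem sigmaL_apply (T : Fin n → H →L[ℂ] H) (X : H →L[ℂ] H) : sigmaL T X = sigma T X := rfl

theorem sigmaL_pow_apply (T : Fin n → H →L[ℂ] H) (k : ℕ) (X : H →L[ℂ] H) :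
    (sigmaL T ^ k) X = (sigma T)^[k] X := by
  rw [Module.End.pow_apply]; rfl

theorem sigma_apply (T : Fin n → H →L[ℂ] H) (X : H →L[ℂ] H) (x : H) :
    sigma T X x = ∑ i, T i (X (adjoint (T i) x)) := by
  simp [sigma, sum_apply]

theorem isPositive_sigma (T : Fin n → H →L[ℂ] H) {X : H →L[ℂ] H} (hX : X.IsPositive) :
    (sigma T X).IsPositive := by
  unfold sigma
  refine Finset.sum_induction _ IsPositive (fun _ _ h1 h2 => h1.add h2) isPositive_zero
    fun i _ => hX.conj_adjoint (T i)

theorem isPositive_sigma_iterate (T : Fin n → H →L[ℂ] H) {X : H →L[ℂ] H} (hX : X.IsPositive)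
    (k : ℕ) : ((sigma T)^[k] X).IsPositive := by
  induction k with
  | zero => simpa
  | succ k ih => rw [Function.iterate_succ_apply']; exact isPositive_sigma T ih

variable {m : ℕ} {T : Fin n → H →L[ℂ] H}

theorem isSelfAdjoint_Delta : adjoint (Delta m T) = Delta m T := by
  unfold Delta
  rw [map_sum]
  refine Finset.sum_congr rfl fun j _ => ?_
  rw [map_smulₛₗ, (isPositive_sigma_iterate T isPositive_one j).isSelfAdjoint.adjoint_eq]
  simp

/-- The source of the coefficients of `Δ_T`: with `σ_T` for `x`, the sum on the right applied to `1`
is `Δ_T`. -/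
theorem one_sub_pow_eq_one_sub_mul {R : Type*} [CommRing R] (x : R) (m : ℕ) :
    (1 - x) ^ m = 1 - x * ∑ j ∈ Finset.range m, (-1) ^ j * (m.choose (j + 1) : R) * x ^ j := by
  rw [sub_eq_neg_add, add_pow, Finset.sum_range_succ', Finset.mul_sum]
  simp only [one_pow, mul_one, pow_zero, Nat.choose_zero_right, Nat.cast_one]
  rw [add_comm, sub_eq_add_neg, ← Finset.sum_neg_distrib]
  congr 1
  refine Finset.sum_congr rfl fun j _ => ?_
  rw [neg_pow]; ring

/-- The left side is `1 - σ_T(Δ_T)`, and by (b) `σ_T(Δ_T) = ∑ T_i Δ_T T_i^* = TL = 1 - P_W`. -/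
theorem one_sub_sigmaL_pow_one (hT : IsClosed (LinearMap.range (rowOp T).toLinearMap : Set H))
    (hid : SatisfiesIdentity m T) :
    ((1 - sigmaL T) ^ m) 1 = (wandering T).starProjection := by
  have h1 := congrArg (Polynomial.aeval (sigmaL T))
    (one_sub_pow_eq_one_sub_mul (Polynomial.X : Polynomial ℂ) m)
  simp only [map_pow, map_sub, map_one, Polynomial.aeval_X, map_mul, map_sum, map_neg,
    map_natCast] at h1
  have h2 : (∑ j ∈ Finset.range m, (-1) ^ j * (m.choose (j + 1) : Module.End ℂ (H →L[ℂ] H)) *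
      sigmaL T ^ j) 1 = Delta m T := by
    rw [LinearMap.sum_apply, Delta]
    refine Finset.sum_congr rfl fun j _ => ?_
    have : ((-1) ^ j * (m.choose (j + 1) : Module.End ℂ (H →L[ℂ] H)) * sigmaL T ^ j) =
      ((-1 : ℂ) ^ j * (m.choose (j + 1) : ℂ)) • sigmaL T ^ j := by
      rw [Algebra.smul_def]; simp
    rw [this, LinearMap.smul_apply, sigmaL_pow_apply]
  rw [h1, LinearMap.sub_apply, Module.End.mul_apply, h2]
  ext x
  rw [Module.End.one_apply, sub_apply, sigmaL_apply, sigma_apply]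
  simp only [← colL_apply_eq hid]
  rw [sum_row_colL hT]
  exact sub_sub_cancel x _

end Sigma

/-! ### Intertwining of the Taylor terms with `T` -/

section Intertwining

/-- A power series vanishing near zero has vanishing coefficients. -/
theorem coeff_eq_zero_of_hasSum_zero {E : Type*} [NormedAddCommGroup E] [NormedSpace ℂ E]
    {c : ℕ → E} (h : ∀ᶠ t : ℂ in 𝓝 0, HasSum (fun k => t ^ k • c k) 0) (k : ℕ) : c k = 0 := by
  let p : FormalMultilinearSeries ℂ ℂ E := fun k =>
    ContinuousMultilinearMap.mkPiRing ℂ (Fin k) (c k)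
  have hp : ∀ k, p.coeff k = c k := fun k => by
    simp [p, FormalMultilinearSeries.coeff]
  have h1 : HasFPowerSeriesAt (fun _ : ℂ => (0 : E)) p 0 := by
    rw [hasFPowerSeriesAt_iff]
    simpa only [hp] using h
  have h2 : p = 0 := h1.eq_zero
  rw [← hp, h2]
  simp [FormalMultilinearSeries.coeff]

variable {n : ℕ} {H : Type*} [NormedAddCommGroup H] [InnerProductSpace ℂ H] [CompleteSpace H]

/-- The linear combination `∑ z_i S_i` of a tuple. -/
def lincomb (S : Fin n → H →L[ℂ] H) (z : Fin n → ℂ) : H →L[ℂ] H := ∑ i, z i • S i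

omit [CompleteSpace H] in
theorem lincomb_apply (S : Fin n → H →L[ℂ] H) (z : Fin n → ℂ) (x : H) :
    lincomb S z x = ∑ i, z i • S i x := by
  simp [lincomb, sum_apply]

/-- The homogeneous term `P_W (∑ z_i L_i)^k` of degree `k` of `x ↦ P_W (1 - ZL)⁻¹ x`. -/
def taylorTerm (T : Fin n → H →L[ℂ] H) (z : Fin n → ℂ) (k : ℕ) : H →L[ℂ] wandering T :=
  wanderingProj T ∘L lincomb (colL T) z ^ k

variable {m : ℕ} {T : Fin n → H →L[ℂ] H}

theorem taylorTerm_zero_row (z : Fin n → ℂ) (i : Fin n) (x : H) :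
    taylorTerm T z 0 (T i x) = 0 :=
  wanderingProj_row T i x

/-- For `y = x + ZLy` one computes `(T - Z)Ly = x - P_W y`. So `P_W y` lies both in the range of `T
- Z` and in `W`, which meet only in `0`. -/
theorem wanderingProj_resolvent_eq_zero
    (hT : IsClosed (LinearMap.range (rowOp T).toLinearMap : Set H)) {z : Fin n → ℂ}
    (hz : IsCompl (LinearMap.range (rowOp fun i => T i - z i • (1 : H →L[ℂ] H)).toLinearMap)
      (wandering T)) {x y : H}
    (hx : x ∈ LinearMap.range (rowOp fun i => T i - z i • (1 : H →L[ℂ] H)).toLinearMap)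
    (hy : y - lincomb (colL T) z y = x) : wanderingProj T y = 0 := by
  have h1 : rowOp (fun i => T i - z i • (1 : H →L[ℂ] H))
      (WithLp.toLp 2 fun i => colL T i y) = x - wanderingProj T y := by
    rw [rowOp_apply]
    simp only [sub_apply, smul_apply, Finset.sum_sub_distrib]
    rw [sum_row_colL hT, ← hy, lincomb_apply]
    simp only [sub_right_comm]
    rfl
  have h2 : (wanderingProj T y : H) = x - (x - wanderingProj T y) := by abel
  have h3 : (wanderingProj T y : H) ∈
      LinearMap.range (rowOp fun i => T i - z i • (1 : H →L[ℂ] H)).toLinearMap := by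
    rw [h2, ← h1]
    exact Submodule.sub_mem _ hx ⟨_, rfl⟩
  exact Subtype.ext (Submodule.disjoint_def.1 hz.disjoint _ h3 (wanderingProj T y).2)

/-- The vector `T_i x - t z_i x` lies in the range of `T - tZ`, so `P_W (1 - tZL)⁻¹` kills it for
small `t`; comparing powers of `t` gives the relation. -/
theorem taylorTerm_succ_row (hreg : IsRegularAtZero T) (z : Fin n → ℂ) (k : ℕ) (i : Fin n)
    (x : H) : taylorTerm T z (k + 1) (T i x) = z i • taylorTerm T z k x := by
  classical
  have hT := hreg.isClosed_range
  obtain ⟨ε, hε, hreg⟩ := hreg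
  -- The coefficient of `t^k` in `P_W (1 - tZL)⁻¹ (T_i x - t z_i x)`; the second summand carries an
  -- extra factor `t`, hence the value `0` at `k = 0`.
  let c : ℕ → wandering T := fun k => taylorTerm T z k (T i x) -
    Nat.casesOn k 0 fun j => z i • taylorTerm T z j x
  suffices h : c (k + 1) = 0 from sub_eq_zero.1 h
  refine coeff_eq_zero_of_hasSum_zero ?_ (k + 1)
  set A := lincomb (colL T) z with hA
  have ev1 : ∀ᶠ t : ℂ in 𝓝 0, ‖t • WithLp.toLp 2 z‖ < ε := by
    have : Tendsto (fun t : ℂ => ‖t • WithLp.toLp 2 z‖) (𝓝 0) (𝓝 ‖(0 : ℂ) • WithLp.toLp 2 z‖) :=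
      Continuous.tendsto (by fun_prop) 0
    rw [zero_smul, norm_zero] at this
    exact this.eventually_lt_const hε
  have ev2 : ∀ᶠ t : ℂ in 𝓝 0, ‖t • A‖ < 1 := by
    have : Tendsto (fun t : ℂ => ‖t • A‖) (𝓝 0) (𝓝 ‖(0 : ℂ) • A‖) :=
      Continuous.tendsto (by fun_prop) 0
    rw [zero_smul, norm_zero] at this
    exact this.eventually_lt_const one_pos
  filter_upwards [ev1, ev2] with t ht1 ht2
  have hlc : lincomb (colL T) (fun i => t * z i) = t • A := by
    simp [hA, lincomb, Finset.smul_sum, smul_smul]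
  have hsum : ∀ v : H, HasSum (fun k => t ^ k • taylorTerm T z k v)
      (wanderingProj T ((∑' k, (t • A) ^ k) v)) := fun v => by
    have h1 := (summable_geometric_of_norm_lt_one ht2).hasSum
    have h2 := ((wanderingProj T).comp (ContinuousLinearMap.apply ℂ H v)).hasSum h1
    convert h2 using 2 with k
    · simp [taylorTerm, smul_pow, hA]
    · rfl
  have hzero : wanderingProj T ((∑' k, (t • A) ^ k) (T i x - (t * z i) • x)) = 0 := by
    refine wanderingProj_resolvent_eq_zero hT (z := fun i => t * z i)
      (x := T i x - (t * z i) • x) (hreg (t • WithLp.toLp 2 z) ht1).2 ?_ ?_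
    · refine ⟨WithLp.toLp 2 (Pi.single i x), ?_⟩
      change rowOp _ _ = _
      rw [rowOp_apply, Finset.sum_eq_single i (by intro j _ hj; simp [hj]) (by simp)]
      simp
    · have := mul_neg_geom_series (t • A) ht2
      rw [hlc]
      exact congrArg (fun B : H →L[ℂ] H => B (T i x - (t * z i) • x)) this
  have s1 := hsum (T i x)
  have s2 : HasSum (fun k => t ^ k • (Nat.casesOn k 0 fun j => z i • taylorTerm T z j x :
      wandering T)) ((t * z i) • wanderingProj T ((∑' k, (t • A) ^ k) x)) := by
    refine (hasSum_nat_add_iff' 1).1 ?_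
    rw [Finset.range_one, Finset.sum_singleton]
    change HasSum (fun k => t ^ (k + 1) • z i • taylorTerm T z k x) (_ - t ^ 0 • 0)
    rw [smul_zero, sub_zero]
    convert (hsum x).const_smul (t * z i) using 2 with k
    simp only [smul_smul]
    congr 1; ring
  have s3 := s1.sub s2
  rw [← map_smul, ← map_smul, ← map_sub, ← map_sub, hzero] at s3
  simpa only [c, smul_sub] using s3

theorem taylorTerm_wandering (hid : SatisfiesIdentity m T) (z : Fin n → ℂ) (k : ℕ)
    (w : wandering T) : taylorTerm T z (k + 1) w = 0 := by
  rw [taylorTerm, comp_apply, pow_succ]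
  change wanderingProj T ((lincomb (colL T) z ^ k) (lincomb (colL T) z w)) = 0
  rw [lincomb_apply]
  simp [colL_wandering hid]

theorem taylorTerm_zero_wandering (z : Fin n → ℂ) (w : wandering T) : taylorTerm T z 0 w = w :=
  wanderingProj_coe T w

end Intertwining

/-! ### Multi-index powers and homogeneous polynomials -/

section MultiIndex

variable {n : ℕ}

theorem multiindex_induction {p : (Fin n → ℕ) → Prop} (h0 : p 0)
    (hs : ∀ α i, p α → p (α + Pi.single i 1)) (α : Fin n → ℕ) : p α := by
  induction hk : ∑ i, α i generalizing α with
  | zero =>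
    have : α = 0 := by
      funext i
      exact (Finset.sum_eq_zero_iff.1 hk) i (Finset.mem_univ i)
    rwa [this]
  | succ k ih =>
    obtain ⟨i, hi⟩ : ∃ i, α i ≠ 0 := by
      by_contra! h
      simp [h] at hk
    have h1 : α = (α - Pi.single i 1) + Pi.single i 1 := by
      funext j
      by_cases hj : j = i
      · subst hj
        simp only [Pi.add_apply, Pi.sub_apply, Pi.single_eq_same]
        omega
      · simp [hj]
    rw [h1] at hk ⊢
    refine hs _ i (ih _ ?_)
    simpa [Finset.sum_add_distrib] using hk

theorem mem_piAntidiag_univ {k : ℕ} {α : Fin n → ℕ} :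
    α ∈ Finset.piAntidiag Finset.univ k ↔ ∑ i, α i = k := by
  simp [Finset.mem_piAntidiag]

variable {H : Type*} [NormedAddCommGroup H] [InnerProductSpace ℂ H]

theorem prod_pow_add_single {R : Type*} [CommMonoid R] (z : Fin n → R) (α : Fin n → ℕ)
    (i : Fin n) : ∏ j, z j ^ (α + Pi.single i 1 : Fin n → ℕ) j = z i * ∏ j, z j ^ α j := by
  simp only [Pi.add_apply, pow_add, Finset.prod_mul_distrib]
  rw [mul_comm, Finset.prod_eq_single i (fun j _ hj => by rw [Pi.single_eq_of_ne hj, pow_zero])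
    (by simp), Pi.single_eq_same, pow_one]

theorem pairwise_commute_pow {S : Fin n → H →L[ℂ] H} (hS : ∀ i j, Commute (S i) (S j))
    (α : Fin n → ℕ) : ((Finset.univ : Finset (Fin n)) : Set (Fin n)).Pairwise
      (Function.onFun Commute fun i => S i ^ α i) :=
  fun i _ j _ _ => (hS i j).pow_pow _ _

theorem mpow_eq_noncommProd {S : Fin n → H →L[ℂ] H} (hS : ∀ i j, Commute (S i) (S j))
    (α : Fin n → ℕ) : mpow S α = Finset.univ.noncommProd (fun i => S i ^ α i)
      (pairwise_commute_pow hS α) := by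
  rw [mpow, List.ofFn_eq_map]
  simp only [Finset.noncommProd]
  exact (Multiset.noncommProd_coe _ _).symm

theorem mpow_zero (S : Fin n → H →L[ℂ] H) : mpow S 0 = 1 := by
  simp [mpow]

theorem mpow_add_single {S : Fin n → H →L[ℂ] H} (hS : ∀ i j, Commute (S i) (S j))
    (α : Fin n → ℕ) (i : Fin n) : mpow S (α + Pi.single i 1) = S i * mpow S α := by
  classical
  rw [mpow_eq_noncommProd hS, mpow_eq_noncommProd hS]
  rw [← Finset.mul_noncommProd_erase _ (Finset.mem_univ i) _
      (pairwise_commute_pow hS α),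
    ← Finset.mul_noncommProd_erase _ (Finset.mem_univ i) _
      (pairwise_commute_pow hS (α + Pi.single i 1)),
    ← mul_assoc, Pi.add_apply, Pi.single_eq_same, pow_succ']
  congr 1
  refine Finset.noncommProd_congr rfl (fun j hj => ?_) _
  rw [Pi.add_apply, Pi.single_eq_of_ne (Finset.ne_of_mem_erase hj), add_zero]

theorem commute_mpow {S : Fin n → H →L[ℂ] H} (hS : ∀ i j, Commute (S i) (S j))
    (α : Fin n → ℕ) (i : Fin n) : Commute (S i) (mpow S α) := by
  induction α using multiindex_induction with
  | h0 => rw [mpow_zero]; exact Commute.one_right _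
  | hs α j h => rw [mpow_add_single hS]; exact (hS i j).mul_right h

theorem lincomb_pow {S : Fin n → H →L[ℂ] H} (hS : ∀ i j, Commute (S i) (S j)) (z : Fin n → ℂ)
    (k : ℕ) : lincomb S z ^ k = ∑ α ∈ Finset.piAntidiag Finset.univ k,
      (∏ i, z i ^ α i) • (Nat.multinomial Finset.univ α : ℂ) • mpow S α := by
  have hc : ∀ i j, Commute (z i • S i) (z j • S j) := fun i j =>
    ((hS i j).smul_left _).smul_right _
  rw [lincomb, Finset.sum_pow_eq_sum_piAntidiag_of_commute _ _ fun i _ j _ _ => hc i j]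
  refine Finset.sum_congr rfl fun α _ => ?_
  have h1 : mpow (fun i => z i • S i) α = (∏ i, z i ^ α i) • mpow S α := by
    clear * - hc hS
    induction α using multiindex_induction with
    | h0 => simp [mpow_zero]
    | hs α i h =>
      rw [mpow_add_single hc, mpow_add_single hS, h, smul_mul_smul_comm]
      rw [prod_pow_add_single z]
  rw [← mpow_eq_noncommProd hc, h1, smul_comm, ← nsmul_eq_mul, Nat.cast_smul_eq_nsmul]

/-- A homogeneous polynomial vanishing on `ℂ^n` has vanishing coefficients. -/
theorem coeff_eq_zero_of_sum_eq_zero {E : Type*} [NormedAddCommGroup E] [InnerProductSpace ℂ E]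
    {k : ℕ} {c : (Fin n → ℕ) → E}
    (h : ∀ z : Fin n → ℂ, ∑ α ∈ Finset.piAntidiag Finset.univ k, (∏ i, z i ^ α i) • c α = 0)
    {α : Fin n → ℕ} (hα : ∑ i, α i = k) : c α = 0 := by
  classical
  -- Pairing with a fixed vector reduces the claim to a scalar polynomial that vanishes as a
  -- function.
  refine ext_inner_left ℂ fun e => ?_
  rw [inner_zero_right]
  let p : MvPolynomial (Fin n) ℂ := ∑ α ∈ Finset.piAntidiag Finset.univ k,
    MvPolynomial.monomial (Finsupp.equivFunOnFinite.symm α) (inner ℂ e (c α))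
  have hp : p = 0 := by
    refine MvPolynomial.funext fun z => ?_
    have := congrArg (fun v => inner ℂ e v) (h z)
    simp only [inner_sum, inner_smul_right, inner_zero_right] at this
    rw [map_zero, map_sum, ← this]
    refine Finset.sum_congr rfl fun β _ => ?_
    rw [MvPolynomial.eval_monomial, mul_comm, Finsupp.prod_fintype _ _ (by simp)]
    simp
  have h1 : MvPolynomial.coeff (Finsupp.equivFunOnFinite.symm α) p = inner ℂ e (c α) := by
    simp only [p, MvPolynomial.coeff_sum, MvPolynomial.coeff_monomial]
    rw [Finset.sum_eq_single α]
    · simp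
    · intro β _ hβ
      rw [if_neg]
      exact fun h => hβ (Finsupp.equivFunOnFinite.symm.injective h)
    · exact fun h => absurd (mem_piAntidiag_univ.2 hα) h
  rw [← h1, hp, MvPolynomial.coeff_zero]

end MultiIndex

/-! ### Taylor coefficients and the characterization of analyticity -/

section TaylorCoefficients

variable {n m : ℕ} {H : Type*} [NormedAddCommGroup H] [InnerProductSpace ℂ H] [CompleteSpace H]

/-- The coefficient `γ_α P_W L^α` of `z^α` in `∑_k P_W (∑ z_i L_i)^k`. -/
def taylorCoef (T : Fin n → H →L[ℂ] H) (α : Fin n → ℕ) : H →L[ℂ] wandering T :=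
  (Nat.multinomial Finset.univ α : ℂ) • (wanderingProj T ∘L mpow (colL T) α)

variable {T : Fin n → H →L[ℂ] H}

theorem taylorTerm_eq_sum (hcomm : ∀ i j, T i * T j = T j * T i) (hid : SatisfiesIdentity m T)
    (z : Fin n → ℂ) (k : ℕ) (x : H) : taylorTerm T z k x =
      ∑ α ∈ Finset.piAntidiag Finset.univ k, (∏ i, z i ^ α i) • taylorCoef T α x := by
  rw [taylorTerm, comp_apply, lincomb_pow (colL_commute hcomm hid)]
  simp [sum_apply, taylorCoef]

theorem taylorTerm_add_mpow (hcomm : ∀ i j, T i * T j = T j * T i) (hreg : IsRegularAtZero T)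
    (z : Fin n → ℂ) (k : ℕ) (α : Fin n → ℕ) (x : H) :
    taylorTerm T z (k + ∑ i, α i) (mpow T α x) = (∏ i, z i ^ α i) • taylorTerm T z k x := by
  induction α using multiindex_induction with
  | h0 => simp [mpow_zero]
  | hs α i h =>
    rw [mpow_add_single hcomm, prod_pow_add_single z, mul_smul, ← h]
    have : ∑ j, (α + Pi.single i 1 : Fin n → ℕ) j = ∑ j, α j + 1 := by
      simp [Finset.sum_add_distrib]
    rw [this, ← add_assoc]
    exact taylorTerm_succ_row hreg z _ i _

theorem taylorTerm_mpow_of_lt (hcomm : ∀ i j, T i * T j = T j * T i) (hreg : IsRegularAtZero T)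
    (z : Fin n → ℂ) (k : ℕ) (α : Fin n → ℕ) (hk : k < ∑ i, α i) (x : H) :
    taylorTerm T z k (mpow T α x) = 0 := by
  induction α using multiindex_induction generalizing k with
  | h0 => simp at hk
  | hs α i h =>
    rw [mpow_add_single hcomm]
    have : ∑ j, (α + Pi.single i 1 : Fin n → ℕ) j = ∑ j, α j + 1 := by
      simp [Finset.sum_add_distrib]
    rw [this] at hk
    rcases k with _ | k
    · exact taylorTerm_zero_row z i _
    · refine (taylorTerm_succ_row hreg z _ i (mpow T α x)).trans ?_
      rw [h k (by omega), smul_zero]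

theorem taylorCoef_eq_zero (hcomm : ∀ i j, T i * T j = T j * T i) (hid : SatisfiesIdentity m T)
    {x : H} (h : ∀ z k, taylorTerm T z k x = 0) (α : Fin n → ℕ) : taylorCoef T α x = 0 := by
  refine coeff_eq_zero_of_sum_eq_zero (c := fun α => taylorCoef T α x) (fun z => ?_) rfl
  rw [← taylorTerm_eq_sum hcomm hid, h]

theorem multinomial_ne_zero (α : Fin n → ℕ) : (Nat.multinomial Finset.univ α : ℂ) ≠ 0 :=
  Nat.cast_ne_zero.2 (Nat.multinomial_pos _ _).ne'

/-- If `P_W x = 0` then `x = ∑ T_i L_i x`, and every `L_i x` inherits the hypothesis; iterating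
peels off `k` factors. -/
theorem mem_iSup_range_mpow (hcomm : ∀ i j, T i * T j = T j * T i)
    (hid : SatisfiesIdentity m T)
    (hT : IsClosed (LinearMap.range (rowOp T).toLinearMap : Set H)) (k : ℕ) (x : H)
    (h : ∀ α, wanderingProj T (mpow (colL T) α x) = 0) :
    x ∈ (⨆ (α : Fin n → ℕ) (_ : ∑ i, α i = k), LinearMap.range (mpow T α).toLinearMap :
      Submodule ℂ H) := by
  induction k generalizing x with
  | zero =>
    refine Submodule.mem_iSup_of_mem 0 (Submodule.mem_iSup_of_mem (by simp) ⟨x, ?_⟩)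
    simp [mpow_zero]
  | succ k ih =>
    have h0 : wanderingProj T x = 0 := by simpa [mpow_zero] using h 0
    have h1 : x = ∑ i, T i (colL T i x) := by
      rw [sum_row_colL hT, h0]; simp
    rw [h1]
    refine Submodule.sum_mem _ fun i _ => ?_
    have h2 := ih (colL T i x) fun α => by
      rw [← h (α + Pi.single i 1), mpow_add_single (colL_commute hcomm hid),
        (commute_mpow (colL_commute hcomm hid) α i).eq]
      rfl
    have h3 : (⨆ (α : Fin n → ℕ) (_ : ∑ i, α i = k), LinearMap.range (mpow T α).toLinearMap :
        Submodule ℂ H) ≤ (⨆ (α : Fin n → ℕ) (_ : ∑ i, α i = k + 1),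
          LinearMap.range (mpow T α).toLinearMap : Submodule ℂ H).comap (T i).toLinearMap := by
      refine iSup₂_le fun α hα => ?_
      rintro _ ⟨y, rfl⟩
      refine Submodule.mem_iSup_of_mem (α + Pi.single i 1) (Submodule.mem_iSup_of_mem ?_ ⟨y, ?_⟩)
      · simp [Finset.sum_add_distrib, hα]
      · rw [mpow_add_single hcomm]; rfl
    exact h3 h2

theorem isAnalytic_iff (hcomm : ∀ i j, T i * T j = T j * T i) (hreg : IsRegularAtZero T)
    (hid : SatisfiesIdentity m T) :
    IsAnalytic T ↔ ∀ x, (∀ z k, taylorTerm T z k x = 0) → x = 0 := by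
  rw [IsAnalytic, Submodule.eq_bot_iff]
  refine forall_congr' fun x => imp_congr_left ⟨fun hx z k => ?_, fun hx => ?_⟩
  -- Degree `k + 1`, because the `k`-th term vanishes on `T^α H` only for `|α|` strictly larger than
  -- `k`.
  · have h1 := (Submodule.mem_iInf _).1 hx (k + 1)
    have h2 : (⨆ (α : Fin n → ℕ) (_ : ∑ i, α i = k + 1), LinearMap.range (mpow T α).toLinearMap :
        Submodule ℂ H) ≤ LinearMap.ker (taylorTerm T z k).toLinearMap := by
      refine iSup₂_le fun α hα => ?_
      rintro _ ⟨y, rfl⟩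
      exact taylorTerm_mpow_of_lt hcomm hreg z k α (by omega) y
    exact h2 h1
  · refine (Submodule.mem_iInf _).2 fun k => ?_
    refine mem_iSup_range_mpow hcomm hid hreg.isClosed_range k x fun α => ?_
    have := taylorCoef_eq_zero hcomm hid hx α
    exact (smul_eq_zero.1 this).resolve_left (multinomial_ne_zero α)

end TaylorCoefficients

/-! ### Iterated backward differences of null sequences -/

section Differences

/-- The backward difference `s_k - s_{k+1}` of a sequence. -/
def backDiff (s : ℕ → ℝ) (k : ℕ) : ℝ := s k - s (k + 1)

theorem tendsto_backDiff_iterate {s : ℕ → ℝ} (hs : Tendsto s atTop (𝓝 0)) (j : ℕ) :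
    Tendsto (backDiff^[j] s) atTop (𝓝 0) := by
  induction j with
  | zero => simpa
  | succ j ih =>
    rw [Function.iterate_succ_apply']
    have := ih.sub (ih.comp (tendsto_add_atTop_nat 1))
    rw [sub_zero] at this
    exact this

theorem nonneg_of_backDiff_nonneg {s : ℕ → ℝ} (hs : Tendsto s atTop (𝓝 0))
    (h : ∀ k, 0 ≤ backDiff s k) (k : ℕ) : 0 ≤ s k :=
  (antitone_nat_of_succ_le fun k => sub_nonneg.1 (h k)).le_of_tendsto hs k

/-- A null sequence with nonnegative differences decreases to `0`, so it is nonnegative; this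
descends from order `m` to every lower order. -/
theorem backDiff_iterate_nonneg {s : ℕ → ℝ} (hs : Tendsto s atTop (𝓝 0)) {m : ℕ}
    (h : ∀ k, 0 ≤ backDiff^[m] s k) {j : ℕ} (hj : j ≤ m) (k : ℕ) : 0 ≤ backDiff^[j] s k := by
  induction hj using Nat.decreasingInduction generalizing k with
  | self => exact h k
  | of_succ j _ ih =>
    refine nonneg_of_backDiff_nonneg (tendsto_backDiff_iterate hs j) (fun k => ?_) k
    rw [← Function.iterate_succ_apply' (f := backDiff)]
    exact ih k

/-- Telescoping. The tail is written as a full sum with a cutoff so that a double sum can be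
interchanged freely in `ENNReal`. -/
theorem tsum_ofReal_backDiff {s : ℕ → ℝ} (hs : Tendsto s atTop (𝓝 0))
    (h : ∀ k, 0 ≤ backDiff s k) (k : ℕ) :
    ∑' l, ENNReal.ofReal (if k ≤ l then backDiff s l else 0) = ENNReal.ofReal (s k) := by
  have h1 : HasSum (fun l => backDiff s (l + k)) (s k) := by
    rw [hasSum_iff_tendsto_nat_of_nonneg fun l => h _]
    have h2 : ∀ N, ∑ l ∈ Finset.range N, backDiff s (l + k) = s k - s (N + k) := fun N => by
      have := Finset.sum_range_sub' (fun l => s (l + k)) N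
      simp only [zero_add] at this
      rw [← this]
      refine Finset.sum_congr rfl fun l _ => ?_
      rw [backDiff, add_right_comm]
    simp only [h2]
    simpa using (hs.comp (tendsto_add_atTop_nat k)).const_sub (s k)
  have h3 : HasSum (fun l => if k ≤ l then backDiff s l else 0) (s k) := by
    rw [← hasSum_nat_add_iff' k]
    rw [Finset.sum_eq_zero fun l hl => if_neg (not_le.2 (Finset.mem_range.1 hl)), sub_zero]
    simpa using h1
  have h4 : ∀ l, 0 ≤ if k ≤ l then backDiff s l else 0 := fun l => by
    split_ifs
    exacts [h l, le_rfl]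
  rw [← ENNReal.ofReal_tsum_of_nonneg h4 h3.summable, h3.tsum_eq]

/-- Repeated summation by parts: each step replaces a difference by the tail sum of the next one,
interchanges the sums, and uses the hockey-stick identity `∑_{k ≤ l} C(k+m, m) = C(l+m+1, m+1)`. -/
theorem tsum_choose_mul_backDiff_iterate {s : ℕ → ℝ} (hs : Tendsto s atTop (𝓝 0)) (m : ℕ)
    (h : ∀ k, 0 ≤ backDiff^[m + 1] s k) :
    ∑' k, ((k + m).choose m : ENNReal) * ENNReal.ofReal (backDiff^[m + 1] s k) =
      ENNReal.ofReal (s 0) := by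
  induction m with
  | zero =>
    have := tsum_ofReal_backDiff hs h 0
    simpa using this
  | succ m ih =>
    rw [← ih fun k => backDiff_iterate_nonneg hs h (by omega) k]
    set d := backDiff^[m + 1] s with hd
    have hd' : backDiff^[m + 1 + 1] s = backDiff d := Function.iterate_succ_apply' _ _ _
    have hpos : ∀ k, 0 ≤ backDiff d k := fun k => hd' ▸ h k
    rw [hd']
    have key := tsum_ofReal_backDiff (s := d) (tendsto_backDiff_iterate hs (m + 1)) hpos
    simp only [← key, ← ENNReal.tsum_mul_left]
    rw [ENNReal.tsum_comm]
    refine tsum_congr fun l => ?_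
    rw [tsum_eq_sum (s := Finset.range (l + 1)) (fun k hk => by
      rw [if_neg (by simpa using hk)]; simp)]
    rw [Finset.sum_congr rfl (g := fun k => ((k + m).choose m : ENNReal) *
      ENNReal.ofReal (backDiff d l)) (fun k hk => by
        rw [if_pos (Nat.lt_succ_iff.1 (Finset.mem_range.1 hk))]), ← Finset.sum_mul,
      ← Nat.cast_sum, Nat.sum_range_add_choose, add_assoc]

theorem hasSum_choose_mul_backDiff_iterate {s : ℕ → ℝ} (hs : Tendsto s atTop (𝓝 0)) (m : ℕ)
    (h : ∀ k, 0 ≤ backDiff^[m + 1] s k) :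
    HasSum (fun k => ((k + m).choose m : ℝ) * backDiff^[m + 1] s k) (s 0) := by
  have h0 : ∀ k, 0 ≤ ((k + m).choose m : ℝ) * backDiff^[m + 1] s k := fun k =>
    mul_nonneg (Nat.cast_nonneg _) (h k)
  have hs0 : 0 ≤ s 0 := backDiff_iterate_nonneg hs h (Nat.zero_le _) 0
  have h1 := tsum_choose_mul_backDiff_iterate hs m h
  have h2 : ∀ k, ((k + m).choose m : ENNReal) * ENNReal.ofReal (backDiff^[m + 1] s k) =
      ENNReal.ofReal (((k + m).choose m : ℝ) * backDiff^[m + 1] s k) := fun k => by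
    rw [ENNReal.ofReal_mul (Nat.cast_nonneg _), ENNReal.ofReal_natCast]
  simp only [h2] at h1
  have h3 : Summable fun k => ((k + m).choose m : ℝ) * backDiff^[m + 1] s k := by
    have := ENNReal.summable_toReal (h1 ▸ ENNReal.ofReal_ne_top)
    simpa only [ENNReal.toReal_ofReal (h0 _)] using this
  have h4 := h3.hasSum
  rw [← ENNReal.ofReal_tsum_of_nonneg h0 h3] at h1
  rwa [(ENNReal.ofReal_eq_ofReal_iff (tsum_nonneg h0) hs0).1 h1] at h4

end Differences

/-! ### Moments of `σ_T^k(1)` and contractive positive operators -/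

section Positivity

variable {n m : ℕ} {H : Type*} [NormedAddCommGroup H] [InnerProductSpace ℂ H] [CompleteSpace H]

omit [CompleteSpace H] in
theorem re_inner_self (x : H) : (inner ℂ x x : ℂ).re = ‖x‖ ^ 2 := by
  rw [inner_self_eq_norm_sq_to_K]; norm_cast

/-- This is `A² ≤ A` for `0 ≤ A ≤ 1`, read off from `⟨A(x - Ax), x - Ax⟩ ≥ 0`. It upgrades
convergence of quadratic forms to strong convergence. -/
theorem norm_sq_le_of_isPositive {A : H →L[ℂ] H} (hA : A.IsPositive)
    (hle : ∀ x, (inner ℂ (A x) x).re ≤ ‖x‖ ^ 2) (x : H) :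
    ‖A x‖ ^ 2 ≤ (inner ℂ (A x) x).re := by
  have h1 : 0 ≤ (inner ℂ (A (x - A x)) (x - A x)).re := hA.re_inner_nonneg_left (x - A x)
  have h2 := hle (A x)
  have h3 : inner ℂ (A (A x)) x = inner ℂ (A x) (A x) := by
    rw [← adjoint_inner_right, hA.isSelfAdjoint.adjoint_eq]
  rw [map_sub, inner_sub_left, inner_sub_right, inner_sub_right, h3] at h1
  simp only [Complex.sub_re, re_inner_self] at h1
  linarith

variable {T : Fin n → H →L[ℂ] H}

/-- The moment sequence `⟨σ_T^k(1) x, x⟩`. -/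
def sigmaMoment (T : Fin n → H →L[ℂ] H) (x : H) (k : ℕ) : ℝ :=
  (inner ℂ ((sigma T)^[k] 1 x) x).re

theorem sigmaMoment_zero (x : H) : sigmaMoment T x 0 = ‖x‖ ^ 2 :=
  re_inner_self x

theorem backDiff_iterate_inner_sigmaL (Y : H →L[ℂ] H) (x : H) (j k : ℕ) :
    (backDiff^[j] fun N => (inner ℂ ((sigmaL T ^ N) Y x) x).re) k =
      (inner ℂ ((sigmaL T ^ k) (((1 - sigmaL T) ^ j) Y) x) x).re := by
  induction j generalizing Y with
  | zero => rfl
  | succ j ih =>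
    rw [Function.iterate_succ_apply]
    have h : backDiff (fun N => (inner ℂ ((sigmaL T ^ N) Y x) x).re) =
        fun N => (inner ℂ ((sigmaL T ^ N) ((1 - sigmaL T) Y) x) x).re := by
      funext N
      rw [backDiff, LinearMap.sub_apply, Module.End.one_apply, map_sub, sub_apply, inner_sub_left,
        Complex.sub_re, pow_succ]
      rfl
    rw [h, ih, pow_succ]
    rfl

theorem backDiff_iterate_sigmaMoment (hreg : IsRegularAtZero T) (hid : SatisfiesIdentity m T)
    (x : H) (k : ℕ) : backDiff^[m] (sigmaMoment T x) k =
      (inner ℂ ((sigma T)^[k] (wandering T).starProjection x) x).re := by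
  have h := backDiff_iterate_inner_sigmaL (T := T) 1 x m k
  rw [one_sub_sigmaL_pow_one hreg.isClosed_range hid] at h
  simp only [sigmaL_pow_apply] at h
  exact h

theorem backDiff_iterate_sigmaMoment_nonneg (hreg : IsRegularAtZero T)
    (hid : SatisfiesIdentity m T) (x : H) (k : ℕ) : 0 ≤ backDiff^[m] (sigmaMoment T x) k := by
  rw [backDiff_iterate_sigmaMoment hreg hid]
  exact (isPositive_sigma_iterate T (.of_isStarProjection isStarProjection_starProjection)
    k).re_inner_nonneg_left x

/-- The bound on the moments makes every `σ_T^N(1)` a contraction, so convergence on a total set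
spreads to all of `H`. -/
theorem isTypeCDotZero_of_dense (hle : ∀ N x, sigmaMoment T x N ≤ ‖x‖ ^ 2) {S : Set H}
    (hS : (Submodule.span ℂ S).topologicalClosure = ⊤)
    (h : ∀ x ∈ S, Tendsto (fun k : ℕ => ((sigma T)^[k] 1) x) atTop (𝓝 0)) :
    IsTypeCDotZero T := by
  have hnorm : ∀ N x, ‖((sigma T)^[N] 1) x‖ ≤ ‖x‖ := fun N x => by
    refine (pow_le_pow_iff_left₀ (norm_nonneg _) (norm_nonneg _) two_ne_zero).1 ?_
    exact (norm_sq_le_of_isPositive (isPositive_sigma_iterate T isPositive_one N)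
      (fun y => hle N y) x).trans (hle N x)
  have hspan : ∀ x ∈ Submodule.span ℂ S,
      Tendsto (fun k : ℕ => ((sigma T)^[k] 1) x) atTop (𝓝 0) := fun x hx => by
    induction hx using Submodule.span_induction with
    | mem x hx => exact h x hx
    | zero => simp
    | add x y _ _ hx hy => simpa using hx.add hy
    | smul a x _ hx => simpa using hx.const_smul a
  intro x
  have hx : x ∈ closure (Submodule.span ℂ S : Set H) := by
    rw [← Submodule.topologicalClosure_coe, hS]; trivial
  rw [Metric.tendsto_atTop]
  intro ε hε
  obtain ⟨y, hy, hxy⟩ := Metric.mem_closure_iff.1 hx (ε / 2) (half_pos hε)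
  obtain ⟨N, hN⟩ := Metric.tendsto_atTop.1 (hspan y hy) (ε / 2) (half_pos hε)
  refine ⟨N, fun k hk => ?_⟩
  have h1 := hN k hk
  rw [dist_zero_right] at h1 ⊢
  have h2 : ((sigma T)^[k] 1) x = ((sigma T)^[k] 1) (x - y) + ((sigma T)^[k] 1) y := by
    rw [← map_add, sub_add_cancel]
  rw [h2]
  have h3 := hnorm k (x - y)
  rw [dist_eq_norm] at hxy
  linarith [norm_add_le (((sigma T)^[k] 1) (x - y)) (((sigma T)^[k] 1) y)]

end Positivity

/-! ### Analytic tuples are of type `C_{·0}` -/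

section Analytic

variable {n m : ℕ} {H : Type*} [NormedAddCommGroup H] [InnerProductSpace ℂ H] [CompleteSpace H]
variable {T : Fin n → H →L[ℂ] H}

theorem adjoint_lincomb_colL (hid : SatisfiesIdentity m T) (w : Fin n → ℂ) :
    adjoint (lincomb (colL T) w) = lincomb T (star w) * Delta m T := by
  refine ContinuousLinearMap.ext fun x => ext_inner_right ℂ fun y => ?_
  change _ = inner ℂ (lincomb T (star w) (Delta m T x)) y
  rw [adjoint_inner_left, lincomb_apply, lincomb_apply, inner_sum, sum_inner]
  refine Finset.sum_congr rfl fun i _ => ?_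
  rw [inner_smul_left, inner_smul_right, colL_apply_eq hid, ← adjoint_inner_right,
    ← adjoint_inner_left (Delta m T), isSelfAdjoint_Delta]
  simp

/-- `u ∈ (ker T)ᗮ` lies in the image of the adjoint of the row operator. -/
theorem mem_imAdj_of_orthogonal
    (hT : IsClosed (LinearMap.range (rowOp T).toLinearMap : Set H)) {u : HilbertPow n H}
    (hu : ∀ h : HilbertPow n H, rowOp T h = 0 → inner ℂ u h = 0) : u ∈ imAdj T := by
  have hg := isInvertible_gram T hT
  set v := gramInv T (colAdjIm T (rowOp T u)) with hv
  have h1 : colAdj T (rowOp T v) = colAdj T (rowOp T u) :=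
    congrArg Subtype.val (hg.self_apply_inverse (colAdjIm T (rowOp T u)))
  have h2 : rowOp T (v - u) = 0 := by
    rw [← inner_self_eq_zero (𝕜 := ℂ), ← adjoint_inner_left]
    change inner ℂ (colAdj T _) _ = _
    rw [map_sub, map_sub, h1, sub_self, inner_zero_left]
  obtain ⟨x, hx⟩ := v.2
  have h3 : inner ℂ (v : HilbertPow n H) (v - u) = 0 := by
    rw [← hx]
    change inner ℂ (adjoint (rowOp T) x) _ = _
    rw [adjoint_inner_left, hx, h2, inner_zero_right]
  have h4 : (v : HilbertPow n H) - u = 0 := by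
    rw [← inner_self_eq_zero (𝕜 := ℂ), inner_sub_left, h3, hu _ h2, sub_zero]
  rw [← sub_eq_zero.1 h4]
  exact v.2

/-- On `Im T^*` the operator `Δ_T` inverts `T^* T`. -/
theorem adjoint_row_Delta (hT : IsClosed (LinearMap.range (rowOp T).toLinearMap : Set H))
    (hid : SatisfiesIdentity m T) {u : HilbertPow n H} (hu : u ∈ imAdj T) (i : Fin n) :
    adjoint (T i) (∑ j, T j (Delta m T (u j))) = u i := by
  have h1 : gram T (gramInv T ⟨u, hu⟩) = ⟨u, hu⟩ :=
    (isInvertible_gram T hT).self_apply_inverse _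
  have h2 : colAdj T (rowOp T (gramInv T ⟨u, hu⟩ : HilbertPow n H)) = u := congrArg Subtype.val h1
  rw [← colAdj_apply]
  conv_rhs => rw [← h2]
  rw [rowOp_apply]
  simp only [hid ⟨u, hu⟩]

section Eigen

variable {w : Fin n → ℂ} {e : H} {k : ℕ}

/-- With `t = ∑ conj(w_i) T_i`: each `T_i^*` lowers `t^(j+1) e` to `a conj(w_i) t^j e`, and applying
`T_i` and summing rebuilds `t^(j+1) e`. More than `j` rounds reach `T_i^* e = 0`. -/
theorem exists_sigma_iterate_eq_smul (he : ∀ i, adjoint (T i) e = 0)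
    (h : ∀ j < k, ∃ a : ℂ, ∀ i, adjoint (T i) ((lincomb T (star w) ^ (j + 1)) e) =
      (a * star (w i)) • (lincomb T (star w) ^ j) e) (N : ℕ) {j : ℕ} (hj : j ≤ k) :
    ∃ b : ℂ, ((sigma T)^[N] 1) ((lincomb T (star w) ^ j) e) = b • (lincomb T (star w) ^ j) e ∧
      (j < N → b = 0) := by
  induction N generalizing j with
  | zero => exact ⟨1, by simp, by simp⟩
  | succ N ih =>
    rw [Function.iterate_succ_apply']
    rcases j with _ | j
    · refine ⟨0, ?_, fun _ => rfl⟩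
      rw [sigma_apply]
      simp [he]
    · obtain ⟨a, ha⟩ := h j hj
      obtain ⟨b, hb, hb0⟩ := ih (j := j) (by omega)
      refine ⟨a * b, ?_, fun hN => by rw [hb0 (by omega), mul_zero]⟩
      rw [sigma_apply]
      simp only [ha, map_smul, hb]
      rw [pow_succ' (lincomb T (star w))]
      change _ = (a * b) • lincomb T (star w) ((lincomb T (star w) ^ j) e)
      rw [lincomb_apply, Finset.smul_sum]
      refine Finset.sum_congr rfl fun i _ => ?_
      simp only [smul_smul, Pi.star_apply]
      congr 1; ring

theorem exists_Delta_eq_smul (he : ∀ i, adjoint (T i) e = 0)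
    (h : ∀ j < k, ∃ a : ℂ, ∀ i, adjoint (T i) ((lincomb T (star w) ^ (j + 1)) e) =
      (a * star (w i)) • (lincomb T (star w) ^ j) e) {j : ℕ} (hj : j ≤ k) :
    ∃ d : ℂ, Delta m T ((lincomb T (star w) ^ j) e) = d • (lincomb T (star w) ^ j) e := by
  choose b hb _ using fun N => exists_sigma_iterate_eq_smul he h N hj
  refine ⟨∑ N ∈ Finset.range m, ((-1) ^ N * (m.choose (N + 1) : ℂ)) * b N, ?_⟩
  rw [Delta, sum_apply, Finset.sum_smul]
  refine Finset.sum_congr rfl fun N _ => ?_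
  rw [smul_apply, hb, smul_smul]

end Eigen

/-- The intertwining relation gives `∑ w_i P_W (∑ w_j L_j)^k h_i = P_W (∑ w_j L_j)^(k+1) Th`, zero
on `ker T`. So the column with entries `conj(w_i) (∑ w_j L_j)^{*k} e` is orthogonal to `ker T`. -/
theorem inner_pow_adjoint_lincomb_colL (hreg : IsRegularAtZero T) (w : Fin n → ℂ)
    (e : wandering T) (k : ℕ) {h : HilbertPow n H} (hh : rowOp T h = 0) :
    inner ℂ ((adjoint (lincomb (colL T) w) ^ k) e) (∑ i, w i • h i) = 0 := by
  have h1 : adjoint (lincomb (colL T) w) ^ k = adjoint (lincomb (colL T) w ^ k) :=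
    (star_pow _ _).symm
  have h2 : taylorTerm T w k (∑ i, w i • h i) = 0 := by
    rw [map_sum]
    simp only [map_smul, ← taylorTerm_succ_row hreg]
    rw [← map_sum, ← rowOp_apply, hh, map_zero]
  rw [h1, adjoint_inner_left, ← inner_wanderingProj]
  change inner ℂ e (taylorTerm T w k _) = 0
  rw [h2, inner_zero_right]

/-- Lower levels make `t^k e` an eigenvector of `Δ_T`, with eigenvalue `d`, and proportional to `(∑
w_j L_j)^{*k} e`. The latter puts the column `u` with entries `conj(w_i) t^k e` into `Im T^*`, where
`Δ_T` inverts `T^*T`; hence `d T_i^* t^(k+1) e = conj(w_i) t^k e`. Both claims must therefore be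
carried through the induction together. -/
theorem exists_adjoint_eq_smul (hreg : IsRegularAtZero T) (hid : SatisfiesIdentity m T)
    (w : Fin n → ℂ) (e : wandering T) (k : ℕ) :
    (∃ a : ℂ, ∀ i, adjoint (T i) ((lincomb T (star w) ^ (k + 1)) (e : H)) =
      (a * star (w i)) • (lincomb T (star w) ^ k) (e : H)) ∧
    ∃ c : ℂ, (lincomb T (star w) ^ (k + 1)) (e : H) =
      c • (adjoint (lincomb (colL T) w) ^ (k + 1)) (e : H) := by
  induction k using Nat.strong_induction_on with
  | _ k ih =>
  have hT := hreg.isClosed_range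
  set t := lincomb T (star w)
  obtain ⟨d, hd⟩ := exists_Delta_eq_smul (m := m) (mem_wandering_iff.1 e.2)
    (fun j hj => (ih j hj).1) le_rfl
  change Delta m T ((t ^ k) (e : H)) = d • (t ^ k) (e : H) at hd
  obtain ⟨c, hc⟩ : ∃ c : ℂ, (t ^ k) (e : H) =
      c • (adjoint (lincomb (colL T) w) ^ k) (e : H) := by
    rcases k with _ | k
    · exact ⟨1, by simp⟩
    · exact (ih k (by omega)).2
  let u : HilbertPow n H := WithLp.toLp 2 fun i => star (w i) • (t ^ k) (e : H)
  have hu : u ∈ imAdj T := by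
    refine mem_imAdj_of_orthogonal hT fun h hh => ?_
    rw [PiLp.inner_apply]
    have := inner_pow_adjoint_lincomb_colL hreg w e k hh
    rw [inner_sum] at this
    simp only [u, inner_smul_left, hc]
    simp only [inner_smul_right] at this
    rw [← mul_zero (star c), ← this, Finset.mul_sum]
    refine Finset.sum_congr rfl fun i _ => ?_
    simp; ring
  have hsucc : (t ^ (k + 1)) (e : H) = ∑ i, T i (u i) := by
    rw [pow_succ']
    change lincomb T (star w) ((t ^ k) (e : H)) = _
    rw [lincomb_apply]
    simp [u]
  have hkey : ∀ i, d • adjoint (T i) ((t ^ (k + 1)) (e : H)) = star (w i) • (t ^ k) (e : H) := by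
    intro i
    refine Eq.trans ?_ (adjoint_row_Delta hT hid hu i)
    rw [← map_smul, hsucc, Finset.smul_sum]
    congr 1
    refine Finset.sum_congr rfl fun j _ => ?_
    simp only [u, map_smul, hd]
    rw [smul_comm]
  -- If `d = 0`, every `conj(w_i) t^k e` vanishes, hence so does `t^(k+1) e`, and the scalars may be
  -- taken zero.
  by_cases hd0 : d = 0
  · have hz : (t ^ (k + 1)) (e : H) = 0 := by
      rw [hsucc]
      refine Finset.sum_eq_zero fun i _ => ?_
      change T i (star (w i) • (t ^ k) (e : H)) = 0
      rw [← hkey, hd0, zero_smul, map_zero]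
    exact ⟨⟨0, fun i => by simp [hz]⟩, ⟨0, by simp [hz]⟩⟩
  · refine ⟨⟨d⁻¹, fun i => ?_⟩, ⟨d⁻¹ * c, ?_⟩⟩
    · rw [mul_smul, ← hkey, inv_smul_smul₀ hd0]
    · have h1 : (t ^ (k + 1)) (e : H) = d⁻¹ • t (Delta m T ((t ^ k) (e : H))) := by
        rw [hd, map_smul, inv_smul_smul₀ hd0, pow_succ']; rfl
      rw [h1, hc, map_smul, map_smul, smul_smul]
      congr 1
      rw [pow_succ' (adjoint _)]
      change _ = adjoint (lincomb (colL T) w) _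
      rw [adjoint_lincomb_colL hid]
      rfl

/-- The converse proportionality: it lets orthogonality to `t^k e` imply orthogonality to `(∑ w_j
L_j)^{*k} e`, even when the eigenvalue of `Δ_T` is zero. -/
theorem exists_pow_adjoint_lincomb_colL_eq_smul (hreg : IsRegularAtZero T)
    (hid : SatisfiesIdentity m T) (w : Fin n → ℂ) (e : wandering T) (k : ℕ) :
    ∃ c : ℂ, (adjoint (lincomb (colL T) w) ^ k) (e : H) =
      c • (lincomb T (star w) ^ k) (e : H) := by
  induction k with
  | zero => exact ⟨1, by simp⟩
  | succ k ih =>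
    obtain ⟨c, hc⟩ := ih
    obtain ⟨d, hd⟩ := exists_Delta_eq_smul (m := m) (k := k) (mem_wandering_iff.1 e.2)
      (fun j _ => (exists_adjoint_eq_smul hreg hid w e j).1) le_rfl
    refine ⟨c * d, ?_⟩
    rw [pow_succ', pow_succ']
    change adjoint (lincomb (colL T) w) ((adjoint (lincomb (colL T) w) ^ k) (e : H)) =
      (c * d) • lincomb T (star w) ((lincomb T (star w) ^ k) (e : H))
    rw [hc, adjoint_lincomb_colL hid, map_smul]
    change c • lincomb T (star w) (Delta m T _) = _
    rw [hd, map_smul, smul_smul]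

theorem IsAnalytic.isTypeCDotZero (hm : 1 ≤ m) (hcomm : ∀ i j, T i * T j = T j * T i)
    (hreg : IsRegularAtZero T) (hid : SatisfiesIdentity m T) (h : IsAnalytic T) :
    IsTypeCDotZero T := by
  let S : Set H := {x | ∃ (w : Fin n → ℂ) (k : ℕ) (e : wandering T),
    x = (lincomb T (star w) ^ k) (e : H)}
  have hS0 : ∀ x ∈ S, ∀ᶠ N in atTop, ((sigma T)^[N] 1) x = 0 := by
    rintro _ ⟨w, k, e, rfl⟩
    filter_upwards [eventually_gt_atTop k] with N hN
    obtain ⟨b, hb, hb0⟩ := exists_sigma_iterate_eq_smul (k := k) (mem_wandering_iff.1 e.2)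
      (fun j _ => (exists_adjoint_eq_smul hreg hid w e j).1) N le_rfl
    rw [hb, hb0 hN, zero_smul]
  have hspan : ∀ x ∈ Submodule.span ℂ S, ∀ᶠ N in atTop, ((sigma T)^[N] 1) x = 0 := fun x hx => by
    induction hx using Submodule.span_induction with
    | mem x hx => exact hS0 x hx
    | zero => simp
    | add x y _ _ hx hy =>
      filter_upwards [hx, hy] with N h1 h2
      rw [map_add, h1, h2, add_zero]
    | smul a x _ hx =>
      filter_upwards [hx] with N h1
      rw [map_smul, h1, smul_zero]
  -- A vector orthogonal to all `t^k e` has only zero Taylor terms, so it vanishes by analyticity.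
  have hdense : (Submodule.span ℂ S).topologicalClosure = ⊤ := by
    rw [Submodule.topologicalClosure_eq_top_iff, Submodule.eq_bot_iff]
    intro x hx
    refine (isAnalytic_iff hcomm hreg hid).1 h x fun w k => ext_inner_left ℂ fun e => ?_
    obtain ⟨c, hc⟩ := exists_pow_adjoint_lincomb_colL_eq_smul hreg hid w e k
    have h1 : adjoint (lincomb (colL T) w) ^ k = adjoint (lincomb (colL T) w ^ k) :=
      (star_pow _ _).symm
    rw [taylorTerm, comp_apply, inner_wanderingProj, ← adjoint_inner_left, ← h1, hc,
      inner_smul_left, hx _ (Submodule.subset_span ⟨w, k, e, rfl⟩), mul_zero, inner_zero_right]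
  -- On the span the moments are eventually zero, so nonnegativity of the `m`-th differences
  -- descends to the first ones; this is where `m ≥ 1` enters.
  have hle : ∀ N, ∀ x ∈ Submodule.span ℂ S, sigmaMoment T x N ≤ ‖x‖ ^ 2 := fun N x hx => by
    have h1 : Tendsto (sigmaMoment T x) atTop (𝓝 0) := by
      refine tendsto_const_nhds.congr' ?_
      filter_upwards [hspan x hx] with N hN
      simp [sigmaMoment, hN]
    have h2 : Antitone (sigmaMoment T x) := antitone_nat_of_succ_le fun k => sub_nonneg.1 <|
      backDiff_iterate_nonneg h1 (backDiff_iterate_sigmaMoment_nonneg hreg hid x) hm k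
    rw [← sigmaMoment_zero (T := T) x]
    exact h2 (Nat.zero_le N)
  refine isTypeCDotZero_of_dense (fun N x => ?_) hdense fun x hx => ?_
  · have hcl : IsClosed {x | sigmaMoment T x N ≤ ‖x‖ ^ 2} := by
      refine isClosed_le ?_ (by fun_prop)
      unfold sigmaMoment
      fun_prop
    have hx : x ∈ closure (Submodule.span ℂ S : Set H) := by
      rw [← Submodule.topologicalClosure_coe, hdense]; trivial
    exact hcl.closure_subset_iff.2 (hle N) hx
  · refine tendsto_const_nhds.congr' ?_
    filter_upwards [hS0 x hx] with N hN
    exact hN.symm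

end Analytic

/-! ### The expansion of the identity for tuples of type `C_{·0}` -/

section Expansion

variable {n m : ℕ} {H : Type*} [NormedAddCommGroup H] [InnerProductSpace ℂ H] [CompleteSpace H]
variable {T : Fin n → H →L[ℂ] H}

theorem IsTypeCDotZero.tendsto_sigmaMoment (h : IsTypeCDotZero T) (x : H) :
    Tendsto (sigmaMoment T x) atTop (𝓝 0) := by
  have h1 := (Complex.continuous_re.tendsto _).comp ((h x).inner (tendsto_const_nhds (x := x)))
  rw [inner_zero_left] at h1
  exact h1

/-- Summing the differences of the moments gives `⟨S_N y, y⟩ → ‖y‖²` for the partial sums. Then `0 ≤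
1 - S_N ≤ 1`, and `norm_sq_le_of_isPositive` turns this into strong convergence. -/
theorem tendsto_sum_choose_smul_sigma (hreg : IsRegularAtZero T)
    (hid : SatisfiesIdentity (m + 1) T) (h : IsTypeCDotZero T) (x : H) :
    Tendsto (fun N => ∑ k ∈ Finset.range N, ((k + m).choose m : ℂ) •
      ((sigma T)^[k] (wandering T).starProjection) x) atTop (𝓝 x) := by
  have hP : ∀ k, ((sigma T)^[k] (wandering T).starProjection).IsPositive := fun k =>
    isPositive_sigma_iterate T (.of_isStarProjection isStarProjection_starProjection) k
  have hsum : ∀ y : H, HasSum (fun k => ((k + m).choose m : ℝ) *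
      (inner ℂ (((sigma T)^[k] (wandering T).starProjection) y) y).re) (‖y‖ ^ 2) := fun y => by
    have := hasSum_choose_mul_backDiff_iterate (h.tendsto_sigmaMoment y) m
      (backDiff_iterate_sigmaMoment_nonneg hreg hid y)
    simpa only [backDiff_iterate_sigmaMoment hreg hid, sigmaMoment_zero] using this
  let S : ℕ → H →L[ℂ] H := fun N => ∑ k ∈ Finset.range N, ((k + m).choose m : ℂ) •
      ((sigma T)^[k] (wandering T).starProjection)
  have hSpos : ∀ N, (S N).IsPositive := fun N => by
    refine Finset.sum_induction _ IsPositive (fun _ _ h1 h2 => h1.add h2) isPositive_zero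
      fun k _ => ?_
    rw [Nat.cast_smul_eq_nsmul]
    induction (k + m).choose m with
    | zero => rw [zero_smul]; exact isPositive_zero
    | succ c ih => rw [succ_nsmul]; exact ih.add (hP k)
  have hSin : ∀ N y, (inner ℂ (S N y) y).re = ∑ k ∈ Finset.range N, ((k + m).choose m : ℝ) *
      (inner ℂ (((sigma T)^[k] (wandering T).starProjection) y) y).re := fun N y => by
    simp only [S, sum_apply, sum_inner, Complex.re_sum, smul_apply, inner_smul_left]
    refine Finset.sum_congr rfl fun k _ => ?_
    simp
  have hle : ∀ N y, (inner ℂ (S N y) y).re ≤ ‖y‖ ^ 2 := fun N y => by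
    rw [hSin]
    exact sum_le_hasSum _ (fun k _ => mul_nonneg (Nat.cast_nonneg _)
      ((hP k).re_inner_nonneg_left y)) (hsum y)
  have hR : ∀ N y, (inner ℂ ((1 - S N) y) y).re = ‖y‖ ^ 2 - (inner ℂ (S N y) y).re :=
    fun N y => by
      rw [sub_apply, inner_sub_left, Complex.sub_re, ← re_inner_self]; rfl
  have hRpos : ∀ N, (1 - S N).IsPositive := fun N => by
    refine isPositive_def'.2 ⟨(IsSelfAdjoint.one _).sub (hSpos N).isSelfAdjoint, fun y => ?_⟩
    change 0 ≤ (inner ℂ ((1 - S N) y) y).re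
    rw [hR]
    exact sub_nonneg.2 (hle N y)
  have hbd : ∀ N, ‖(1 - S N) x‖ ^ 2 ≤ ‖x‖ ^ 2 - (inner ℂ (S N x) x).re := fun N => by
    rw [← hR]
    refine norm_sq_le_of_isPositive (hRpos N) (fun y => ?_) x
    rw [hR]
    exact sub_le_self _ ((hSpos N).re_inner_nonneg_left y)
  have hlim : Tendsto (fun N => ‖x‖ ^ 2 - (inner ℂ (S N x) x).re) atTop (𝓝 0) := by
    simp only [hSin]
    have := ((hsum x).tendsto_sum_nat).const_sub (‖x‖ ^ 2)
    rwa [sub_self] at this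
  have h1 : Tendsto (fun N => ‖(1 - S N) x‖ ^ 2) atTop (𝓝 0) :=
    squeeze_zero (fun N => sq_nonneg _) hbd hlim
  have h2 : Tendsto (fun N => ‖(1 - S N) x‖) atTop (𝓝 0) := by
    simpa using h1.sqrt
  have h3 := (tendsto_zero_iff_norm_tendsto_zero.2 h2).const_sub x
  rw [sub_zero] at h3
  refine h3.congr fun N => ?_
  simp [S, sum_apply]

theorem taylorTerm_sigma (hreg : IsRegularAtZero T) (z : Fin n → ℂ) (l : ℕ) (X : H →L[ℂ] H)
    (x : H) : taylorTerm T z (l + 1) (sigma T X x) =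
      taylorTerm T z l (X (lincomb (fun i => adjoint (T i)) z x)) := by
  rw [sigma_apply, lincomb_apply, map_sum, map_sum, map_sum]
  refine Finset.sum_congr rfl fun i _ => ?_
  rw [taylorTerm_succ_row hreg, map_smul, map_smul]

theorem taylorTerm_zero_sigma (z : Fin n → ℂ) (X : H →L[ℂ] H)
    (x : H) : taylorTerm T z 0 (sigma T X x) = 0 := by
  rw [sigma_apply, map_sum]
  exact Finset.sum_eq_zero fun i _ => taylorTerm_zero_row z i _

theorem taylorTerm_sigma_iterate (hreg : IsRegularAtZero T) (hid : SatisfiesIdentity m T)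
    (z : Fin n → ℂ) (l k : ℕ) (x : H) :
    taylorTerm T z l (((sigma T)^[k] (wandering T).starProjection) x) =
      if k = l then wanderingProj T ((lincomb (fun i => adjoint (T i)) z ^ l) x) else 0 := by
  induction k generalizing l x with
  | zero =>
    rcases l with _ | l
    · exact taylorTerm_zero_wandering z (wanderingProj T x)
    · exact taylorTerm_wandering hid z l (wanderingProj T x)
  | succ k ih =>
    rw [Function.iterate_succ_apply']
    rcases l with _ | l
    · simpa using taylorTerm_zero_sigma z _ x
    · rw [taylorTerm_sigma hreg, ih, pow_succ]
      simp only [Nat.add_right_cancel_iff]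
      rfl

/-- Apply the degree-`l` term to the expansion of `x`: each `σ_T` raises the degree by one, so only
the summand `k = l` survives. -/
theorem taylorTerm_eq_choose_smul (hreg : IsRegularAtZero T)
    (hid : SatisfiesIdentity (m + 1) T) (h : IsTypeCDotZero T) (z : Fin n → ℂ) (l : ℕ) (x : H) :
    taylorTerm T z l x = ((l + m).choose m : ℂ) •
      wanderingProj T ((lincomb (fun i => adjoint (T i)) z ^ l) x) := by
  have h1 := ((taylorTerm T z l).continuous.tendsto x).comp
    (tendsto_sum_choose_smul_sigma hreg hid h x)
  refine tendsto_nhds_unique h1 (tendsto_const_nhds.congr' ?_)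
  filter_upwards [eventually_gt_atTop l] with N hN
  simp only [Function.comp_apply, map_sum, map_smul, taylorTerm_sigma_iterate hreg hid]
  rw [Finset.sum_eq_single l]
  · simp
  · intro k _ hk
    simp [hk]
  · intro h
    exact absurd (Finset.mem_range.2 hN) h

theorem commute_adjoint (hcomm : ∀ i j, T i * T j = T j * T i) (i j : Fin n) :
    Commute (adjoint (T i)) (adjoint (T j)) :=
  Commute.star_star (x := T i) (y := T j) (hcomm i j)

theorem mpow_adjoint (hcomm : ∀ i j, T i * T j = T j * T i) (α : Fin n → ℕ) :
    mpow (fun i => adjoint (T i)) α = adjoint (mpow T α) := by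
  induction α using multiindex_induction with
  | h0 => rw [mpow_zero, mpow_zero]; exact (star_one (H →L[ℂ] H)).symm
  | hs α i h =>
    rw [mpow_add_single (commute_adjoint hcomm), mpow_add_single hcomm,
      (commute_mpow hcomm α i).eq, h]
    exact (star_mul (mpow T α) (T i)).symm

theorem taylorCoef_eq_choose_smul (hcomm : ∀ i j, T i * T j = T j * T i)
    (hreg : IsRegularAtZero T) (hid : SatisfiesIdentity (m + 1) T) (h : IsTypeCDotZero T)
    (α : Fin n → ℕ) (x : H) : taylorCoef T α x =
      (((∑ i, α i + m).choose m : ℂ) * (Nat.multinomial Finset.univ α : ℂ)) •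
        wanderingProj T (adjoint (mpow T α) x) := by
  refine sub_eq_zero.1 (coeff_eq_zero_of_sum_eq_zero (k := ∑ i, α i)
    (c := fun α => taylorCoef T α x -
      (((∑ i, α i + m).choose m : ℂ) * (Nat.multinomial Finset.univ α : ℂ)) •
        wanderingProj T (adjoint (mpow T α) x)) (fun z => ?_) rfl)
  simp only [smul_sub, Finset.sum_sub_distrib]
  rw [← taylorTerm_eq_sum hcomm hid, taylorTerm_eq_choose_smul hreg hid h,
    lincomb_pow (commute_adjoint hcomm), sub_eq_zero, sum_apply, map_sum, Finset.smul_sum]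
  refine Finset.sum_congr rfl fun β hβ => ?_
  rw [mem_piAntidiag_univ.1 hβ, smul_apply, smul_apply, map_smul, map_smul, mpow_adjoint hcomm,
    smul_smul, smul_smul, smul_smul]
  congr 1; ring

theorem taylorCoef_mpow (hcomm : ∀ i j, T i * T j = T j * T i)
    (hreg : IsRegularAtZero T) (hid : SatisfiesIdentity m T) (α : Fin n → ℕ) (e : wandering T) :
    taylorCoef T α (mpow T α e) = e := by
  classical
  have h1 := coeff_eq_zero_of_sum_eq_zero (k := ∑ i, α i) (α := α)
    (c := fun β => taylorCoef T β (mpow T α e) - if β = α then e else 0) (fun z => by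
      simp only [smul_sub, Finset.sum_sub_distrib]
      rw [← taylorTerm_eq_sum hcomm hid]
      have := taylorTerm_add_mpow hcomm hreg z 0 α e
      rw [zero_add, taylorTerm_zero_wandering] at this
      rw [this, Finset.sum_eq_single α (fun β _ hβ => by rw [if_neg hβ, smul_zero])
        (fun h => absurd (mem_piAntidiag_univ.2 rfl) h), if_pos rfl, sub_self]) rfl
  simpa [sub_eq_zero] using h1

/-- On `W` the adjoint of the coefficient is `q T^α`, and the coefficient maps `T^α e` back to `e`;
so `‖(taylorCoef T α)^* e‖² = q ‖e‖²`. -/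
theorem norm_taylorCoef_le (hcomm : ∀ i j, T i * T j = T j * T i)
    (hreg : IsRegularAtZero T) (hid : SatisfiesIdentity (m + 1) T) (h : IsTypeCDotZero T)
    (α : Fin n → ℕ) : ‖taylorCoef T α‖ ≤
      √(((∑ i, α i + m).choose m : ℝ) * (Nat.multinomial Finset.univ α : ℝ)) := by
  set q : ℝ := ((∑ i, α i + m).choose m : ℝ) * (Nat.multinomial Finset.univ α : ℝ) with hq
  have hq0 : 0 ≤ q := by positivity
  rw [← LinearIsometryEquiv.norm_map adjoint]
  refine opNorm_le_bound _ (Real.sqrt_nonneg _) fun e => ?_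
  have h1 : adjoint (taylorCoef T α) e = (q : ℂ) • mpow T α e := by
    refine ext_inner_right ℂ fun x => ?_
    rw [adjoint_inner_left, taylorCoef_eq_choose_smul hcomm hreg hid h, inner_smul_right,
      inner_wanderingProj, adjoint_inner_right, inner_smul_left, hq]
    simp
  have h2 : ‖adjoint (taylorCoef T α) e‖ ^ 2 = q * ‖e‖ ^ 2 := by
    have h3 : (inner ℂ (adjoint (taylorCoef T α) e) (adjoint (taylorCoef T α) e) : ℂ) =
        (q : ℂ) * inner ℂ e e := by
      conv_lhs => rw [adjoint_inner_left, h1, map_smul, taylorCoef_mpow hcomm hreg hid,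
        inner_smul_right]
    rw [← re_inner_self, h3, Complex.re_ofReal_mul, re_inner_self]
  refine (pow_le_pow_iff_left₀ (norm_nonneg _) (by positivity) two_ne_zero).1 ?_
  rw [h2, mul_pow, Real.sq_sqrt hq0]

/-- Vanishing coefficients mean `P_W T^{*α} x = 0` for all `α`, which annihilates every term of the
expansion of `x`. -/
theorem IsTypeCDotZero.eq_zero_of_taylorTerm (hcomm : ∀ i j, T i * T j = T j * T i)
    (hreg : IsRegularAtZero T) (hid : SatisfiesIdentity (m + 1) T) (h : IsTypeCDotZero T)
    {x : H} (hx : ∀ z k, taylorTerm T z k x = 0) : x = 0 := by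
  have h1 : ∀ α, wanderingProj T (adjoint (mpow T α) x) = 0 := fun α => by
    have h2 := taylorCoef_eq_zero hcomm hid hx α
    rw [taylorCoef_eq_choose_smul hcomm hreg hid h] at h2
    refine (smul_eq_zero.1 h2).resolve_left (mul_ne_zero ?_ (multinomial_ne_zero α))
    exact Nat.cast_ne_zero.2 (Nat.choose_pos (by omega)).ne'
  have h3 : ∀ (k : ℕ) (y : H), (∀ α, wanderingProj T (adjoint (mpow T α) y) = 0) →
      ((sigma T)^[k] (wandering T).starProjection) y = 0 := by
    intro k
    induction k with
    | zero =>
      intro y hy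
      have h4 : wanderingProj T y = 0 := by
        have := hy 0
        rw [← mpow_adjoint hcomm, mpow_zero] at this
        exact this
      exact congrArg Subtype.val h4
    | succ k ih =>
      intro y hy
      rw [Function.iterate_succ_apply', sigma_apply]
      refine Finset.sum_eq_zero fun i _ => ?_
      rw [ih, map_zero]
      intro α
      rw [← hy (α + Pi.single i 1), mpow_add_single hcomm]
      congr 1
      exact congrArg (fun A : H →L[ℂ] H => A y) (star_mul (T i) (mpow T α)).symm
  have h5 := tendsto_sum_choose_smul_sigma hreg hid h x
  simp only [h3 _ x h1, smul_zero, Finset.sum_const_zero] at h5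
  exact tendsto_nhds_unique h5 tendsto_const_nhds

end Expansion

/-! ### Convergence on the ball and the reproducing kernel identity -/

section Evaluation

variable {n m : ℕ}

theorem summable_of_summable_piAntidiag {f : (Fin n → ℕ) → ℝ} (hf : ∀ α, 0 ≤ f α)
    (h : Summable fun k => ∑ α ∈ Finset.piAntidiag Finset.univ k, f α) : Summable f := by
  classical
  refine summable_of_sum_le hf (c := ∑' k, ∑ α ∈ Finset.piAntidiag Finset.univ k, f α)
    fun u => ?_
  let N := u.sup (fun α => ∑ i, α i) + 1
  have hmap : ∀ α ∈ u, ∑ i, α i ∈ Finset.range N := fun α hα =>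
    Finset.mem_range.2 (Nat.lt_succ_iff.2 (Finset.le_sup (f := fun α => ∑ i, α i) hα))
  rw [← Finset.sum_fiberwise_of_maps_to hmap]
  refine le_trans (Finset.sum_le_sum fun k _ => ?_)
    (h.sum_le_tsum (Finset.range N) fun k _ => Finset.sum_nonneg fun α _ => hf α)
  refine Finset.sum_le_sum_of_subset_of_nonneg (fun α hα => ?_) fun α _ _ => hf α
  exact mem_piAntidiag_univ.2 (Finset.mem_filter.1 hα).2

theorem hasSum_piAntidiag {E : Type*} [NormedAddCommGroup E] [NormedSpace ℂ E] [CompleteSpace E]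
    {f : (Fin n → ℕ) → E} {a : E} (h : HasSum f a) :
    HasSum (fun k => ∑ α ∈ Finset.piAntidiag Finset.univ k, f α) a := by
  convert h.tsum_fiberwise (fun α => ∑ i, α i) using 2 with k
  rw [← Finset.tsum_subtype]
  have : ((Finset.piAntidiag Finset.univ k : Finset (Fin n → ℕ)) : Set (Fin n → ℕ)) =
      (fun α => ∑ i, α i) ⁻¹' {k} := by
    ext α
    simp
  rw [← this]
  rfl

theorem card_piAntidiag_univ_le (k : ℕ) :
    (Finset.piAntidiag (Finset.univ : Finset (Fin n)) k).card ≤ (k + 1) ^ n := by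
  classical
  calc _ ≤ (Fintype.piFinset fun _ : Fin n => Finset.range (k + 1)).card := by
        refine Finset.card_le_card fun α hα => ?_
        rw [Fintype.mem_piFinset]
        intro i
        rw [Finset.mem_range, Nat.lt_succ_iff, ← mem_piAntidiag_univ.1 hα]
        exact Finset.single_le_sum (f := α) (fun j _ => Nat.zero_le _) (Finset.mem_univ i)
    _ = (k + 1) ^ n := by simp

/-- Choose `ρ` between `r` and `1` and split by AM-GM with weight `ρ^|α|`. In degree `k` the
multinomial theorem sums the first part to `C(k+m, m)(r/ρ)^k`; the second is `ρ^k` times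
polynomially many terms. -/
theorem summable_prod_pow_mul_sqrt (m : ℕ) {b : Fin n → ℝ} (hb : ∀ i, 0 ≤ b i)
    (hb1 : ∑ i, b i ^ 2 < 1) : Summable fun α : Fin n → ℕ => (∏ i, b i ^ α i) *
      √(((∑ i, α i + m).choose m : ℝ) * (Nat.multinomial Finset.univ α : ℝ)) := by
  set r := ∑ i, b i ^ 2 with hr
  have hr0 : 0 ≤ r := Finset.sum_nonneg fun i _ => sq_nonneg _
  obtain ⟨ρ, h1, h2⟩ := exists_between hb1
  have hρ : 0 < ρ := hr0.trans_lt h1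
  have hb0 : ∀ α : Fin n → ℕ, 0 ≤ ∏ i, b i ^ α i := fun α =>
    Finset.prod_nonneg fun i _ => pow_nonneg (hb i) _
  let g : (Fin n → ℕ) → ℝ := fun α => (((∑ i, α i + m).choose m : ℝ) *
    (Nat.multinomial Finset.univ α : ℝ)) * (∏ i, b i ^ α i) ^ 2 / ρ ^ (∑ i, α i) +
      ρ ^ (∑ i, α i)
  have hg0 : ∀ α, 0 ≤ g α := fun α => by positivity
  have hfg : ∀ α, (∏ i, b i ^ α i) *
      √(((∑ i, α i + m).choose m : ℝ) * (Nat.multinomial Finset.univ α : ℝ)) ≤ g α := fun α => by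
    simp only [g]
    set c := ((∑ i, α i + m).choose m : ℝ) * (Nat.multinomial Finset.univ α : ℝ) with hc
    have hc0 : 0 ≤ c := by positivity
    set p := ∏ i, b i ^ α i with hp
    set s := ρ ^ (∑ i, α i) with hs
    have hs0 : 0 < s := pow_pos hρ _
    have e1 : (p * √c / √s) ^ 2 = c * p ^ 2 / s := by
      rw [div_pow, mul_pow, Real.sq_sqrt hc0, Real.sq_sqrt hs0.le]; ring
    have e2 : √s ^ 2 = s := Real.sq_sqrt hs0.le
    have e3 : p * √c / √s * √s = p * √c := div_mul_cancel₀ _ (Real.sqrt_pos.2 hs0).ne'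
    have e4 : 0 ≤ p * √c := mul_nonneg (hb0 α) (Real.sqrt_nonneg _)
    have e5 := two_mul_le_add_sq (p * √c / √s) (√s)
    rw [e1, e2, mul_assoc, e3] at e5
    linarith
  refine Summable.of_nonneg_of_le (fun α => mul_nonneg (hb0 α) (Real.sqrt_nonneg _)) hfg ?_
  refine summable_of_summable_piAntidiag hg0 ?_
  have hsum : ∀ k, ∑ α ∈ Finset.piAntidiag Finset.univ k, g α =
      ((k + m).choose m : ℝ) * (r / ρ) ^ k +
        ((Finset.piAntidiag (Finset.univ : Finset (Fin n)) k).card : ℝ) * ρ ^ k := fun k => by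
    rw [Finset.sum_add_distrib]
    congr 1
    · have := Finset.sum_pow_eq_sum_piAntidiag Finset.univ (fun i => b i ^ 2) k
      rw [div_pow, hr, this, Finset.sum_div, Finset.mul_sum]
      refine Finset.sum_congr rfl fun α hα => ?_
      rw [mem_piAntidiag_univ.1 hα, ← Finset.prod_pow]
      have : ∀ i, (b i ^ α i) ^ 2 = (b i ^ 2) ^ α i := fun i => by
        rw [← pow_mul, ← pow_mul, mul_comm]
      simp only [this]
      ring
    · rw [Finset.sum_congr rfl fun α hα => by rw [mem_piAntidiag_univ.1 hα], Finset.sum_const,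
        nsmul_eq_mul]
  simp only [hsum]
  refine Summable.add ?_ ?_
  · refine summable_choose_mul_geometric_of_norm_lt_one m ?_
    rw [Real.norm_of_nonneg (by positivity)]
    exact (div_lt_one hρ).2 h1
  · have h3 : Summable fun k : ℕ => ((k : ℝ) + 1) ^ n * ρ ^ k := by
      have := (summable_nat_add_iff 1).2 (summable_pow_mul_geometric_of_norm_lt_one n
        (r := ρ) (by rwa [Real.norm_of_nonneg hρ.le]))
      refine (this.mul_right ρ⁻¹).congr fun k => ?_
      rw [pow_succ]
      push_cast
      field_simp
    refine Summable.of_nonneg_of_le (fun k => by positivity) (fun k => ?_) h3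
    refine mul_le_mul_of_nonneg_right ?_ (by positivity)
    exact_mod_cast card_piAntidiag_univ_le k

theorem summable_smul_of_norm_le {ι E F : Type*} [NormedAddCommGroup E] [NormedSpace ℂ E]
    [NormedAddCommGroup F] [NormedSpace ℂ F] [CompleteSpace F] (c : ι → ℂ) (A : ι → E →L[ℂ] F)
    {g : ι → ℝ} (hg : Summable g) (h : ∀ i, ‖c i‖ * ‖A i‖ ≤ g i) :
    Summable fun i => c i • A i :=
  Summable.of_norm_bounded hg fun i => by rw [norm_smul]; exact h i

theorem hasSum_tsum_smul_apply {ι E F : Type*} [NormedAddCommGroup E] [NormedSpace ℂ E]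
    [NormedAddCommGroup F] [NormedSpace ℂ F] (c : ι → ℂ) (A : ι → E →L[ℂ] F)
    (h : Summable fun i => c i • A i) (x : E) :
    HasSum (fun i => c i • A i x) ((∑' i, c i • A i) x) := by
  have := (ContinuousLinearMap.apply ℂ F x).hasSum h.hasSum
  simpa only [apply_apply, smul_apply] using this

variable {H : Type*} [NormedAddCommGroup H] [InnerProductSpace ℂ H] [CompleteSpace H]

/-- The operator `x ↦ ∑_α γ_α (P_W L^α x) z^α`. -/
def evalOp (T : Fin n → H →L[ℂ] H) (z : Ball n) : H →L[ℂ] wandering T :=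
  ∑' α : Fin n → ℕ, (∏ i, z.1 i ^ α i) • taylorCoef T α

variable {T : Fin n → H →L[ℂ] H}

theorem hasSum_evalOp (hcomm : ∀ i j, T i * T j = T j * T i)
    (hreg : IsRegularAtZero T) (hid : SatisfiesIdentity (m + 1) T) (h : IsTypeCDotZero T)
    (z : Ball n) (x : H) :
    HasSum (fun α : Fin n → ℕ => (∏ i, z.1 i ^ α i) • taylorCoef T α x) (evalOp T z x) := by
  have h1 : Summable fun α : Fin n → ℕ => (∏ i, z.1 i ^ α i) • taylorCoef T α := by
    have hz : ∑ i, ‖z.1 i‖ ^ 2 < 1 := by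
      have hz := mem_ball_zero_iff.1 z.2
      have := pow_lt_one₀ (norm_nonneg _) hz two_ne_zero
      rwa [EuclideanSpace.norm_sq_eq] at this
    have hs := summable_prod_pow_mul_sqrt m (fun i => norm_nonneg (z.1 i)) hz
    refine summable_smul_of_norm_le _ _ hs fun α => ?_
    have h2 : ‖∏ i, z.1 i ^ α i‖ = ∏ i, ‖z.1 i‖ ^ α i := by
      rw [norm_prod]
      exact Finset.prod_congr rfl fun i _ => norm_pow _ _
    rw [h2]
    exact mul_le_mul_of_nonneg_left (norm_taylorCoef_le hcomm hreg hid h α)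
      (h2 ▸ norm_nonneg _)
  exact hasSum_tsum_smul_apply _ _ h1 x

theorem hasSum_taylorTerm (hcomm : ∀ i j, T i * T j = T j * T i)
    (hreg : IsRegularAtZero T) (hid : SatisfiesIdentity (m + 1) T) (h : IsTypeCDotZero T)
    (z : Ball n) (x : H) : HasSum (fun k => taylorTerm T z.1 k x) (evalOp T z x) := by
  simp only [taylorTerm_eq_sum hcomm hid]
  exact hasSum_piAntidiag (hasSum_evalOp hcomm hreg hid h z x)

theorem evalOp_row (hcomm : ∀ i j, T i * T j = T j * T i)
    (hreg : IsRegularAtZero T) (hid : SatisfiesIdentity (m + 1) T) (h : IsTypeCDotZero T)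
    (z : Ball n) (i : Fin n) (x : H) : evalOp T z (T i x) = z.1 i • evalOp T z x := by
  have h1 := (hasSum_nat_add_iff' 1).2 (hasSum_taylorTerm hcomm hreg hid h z (T i x))
  rw [Finset.range_one, Finset.sum_singleton, taylorTerm_zero_row, sub_zero] at h1
  simp only [taylorTerm_succ_row hreg] at h1
  exact h1.unique ((hasSum_taylorTerm hcomm hreg hid h z x).const_smul _)

theorem evalOp_wandering (hcomm : ∀ i j, T i * T j = T j * T i)
    (hreg : IsRegularAtZero T) (hid : SatisfiesIdentity (m + 1) T) (h : IsTypeCDotZero T)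
    (z : Ball n) (e : wandering T) : evalOp T z e = e := by
  have h1 := hasSum_taylorTerm hcomm hreg hid h z e
  refine (h1.unique (hasSum_single 0 fun k hk => ?_)).trans (taylorTerm_zero_wandering z.1 e)
  obtain ⟨k, rfl⟩ := Nat.exists_eq_succ_of_ne_zero hk
  exact taylorTerm_wandering hid z.1 k e

/-- On a joint eigenvector, `σ_T(X)y = ∑ conj(w_i) T_i X y`, so `σ_T` acts as left multiplication by
`∑ conj(w_i) T_i`. -/
theorem one_sub_sigmaL_pow_apply {w : Fin n → ℂ} {y : H}
    (hy : ∀ i, adjoint (T i) y = star (w i) • y) (j : ℕ) :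
    (((1 - sigmaL T) ^ j) 1) y = ((1 - lincomb T (star w)) ^ j) y := by
  induction j with
  | zero => rfl
  | succ j ih =>
    rw [pow_succ', pow_succ']
    change ((1 - sigmaL T) (((1 - sigmaL T) ^ j) 1)) y =
      (1 - lincomb T (star w)) (((1 - lincomb T (star w)) ^ j) y)
    rw [LinearMap.sub_apply, sub_apply, sub_apply, ← ih, sigmaL_apply, sigma_apply, lincomb_apply]
    simp only [hy, map_smul]
    rfl

/-- The vector `y = F(w)^* e` satisfies `T_i^* y = conj(w_i) y` and `P_W y = e`. Evaluating `(1 -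
σ_T)^(m+1)(1) = P_W` at `y` gives `(1 - ∑ conj(w_i) T_i)^(m+1) y = e`; applying `F(z)` turns the
operator into the scalar `(1 - ⟨z,w⟩)^(m+1)`. -/
theorem evalOp_adjoint_evalOp (hcomm : ∀ i j, T i * T j = T j * T i)
    (hreg : IsRegularAtZero T) (hid : SatisfiesIdentity (m + 1) T) (h : IsTypeCDotZero T)
    (z w : Ball n) (e : wandering T) :
    evalOp T z (adjoint (evalOp T w) e) = besovKernel n (m + 1) (wandering T) z w e := by
  set y := adjoint (evalOp T w) e with hy
  have h1 : ∀ i, adjoint (T i) y = star (w.1 i) • y := fun i => by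
    refine ext_inner_right ℂ fun x => ?_
    rw [adjoint_inner_left, hy, adjoint_inner_left, inner_smul_left, adjoint_inner_left,
      evalOp_row hcomm hreg hid h, inner_smul_right]
    simp
  have h2 : wanderingProj T y = e := by
    refine ext_inner_left ℂ fun f => ?_
    rw [inner_wanderingProj, hy, adjoint_inner_right, evalOp_wandering hcomm hreg hid h]
  have h3 : ((1 - lincomb T (star w.1.ofLp)) ^ (m + 1)) y = (e : H) := by
    rw [← one_sub_sigmaL_pow_apply h1, one_sub_sigmaL_pow_one hreg.isClosed_range hid, ← h2]
    rfl
  have h4 : ∀ x, evalOp T z (lincomb T (star w.1.ofLp) x) = inner ℂ w.1 z.1 • evalOp T z x := by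
    intro x
    rw [lincomb_apply, map_sum, PiLp.inner_apply, Finset.sum_smul]
    refine Finset.sum_congr rfl fun i _ => ?_
    rw [map_smul, evalOp_row hcomm hreg hid h, smul_smul]
    congr 1
    simp [mul_comm]
  have h5 : ∀ (j : ℕ) (x : H), evalOp T z (((1 - lincomb T (star w.1.ofLp)) ^ j) x) =
      (1 - inner ℂ w.1 z.1) ^ j • evalOp T z x := by
    intro j
    induction j with
    | zero => intro x; simp
    | succ j ih =>
      intro x
      rw [pow_succ]
      change evalOp T z (((1 - lincomb T (star w.1.ofLp)) ^ j)
        (x - lincomb T (star w.1.ofLp) x)) = _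
      rw [ih, map_sub, h4, pow_succ, mul_smul, sub_smul, one_smul]
  have h6 : (1 - inner ℂ w.1 z.1 : ℂ) ≠ 0 := fun h0 => by
    have := inner_lt_one n w z
    rw [← sub_eq_zero.1 h0, norm_one] at this
    exact lt_irrefl _ this
  have h7 := h5 (m + 1) y
  rw [h3, evalOp_wandering hcomm hreg hid h] at h7
  change _ = ((1 - inner ℂ w.1 z.1) ^ (m + 1))⁻¹ • e
  conv_rhs => rw [h7]
  rw [inv_smul_smul₀ (pow_ne_zero _ h6)]

theorem eq_zero_of_evalOp_eq_zero (hcomm : ∀ i j, T i * T j = T j * T i)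
    (hreg : IsRegularAtZero T) (hid : SatisfiesIdentity (m + 1) T) (h : IsTypeCDotZero T)
    {x : H} (hx : ∀ z, evalOp T z x = 0) : x = 0 := by
  refine h.eq_zero_of_taylorTerm hcomm hreg hid fun z k => ?_
  refine coeff_eq_zero_of_hasSum_zero (c := fun k => taylorTerm T z k x) ?_ k
  have ev : ∀ᶠ t : ℂ in 𝓝 0, ‖t • WithLp.toLp 2 z‖ < 1 := by
    have : Tendsto (fun t : ℂ => ‖t • WithLp.toLp 2 z‖) (𝓝 0) (𝓝 ‖(0 : ℂ) • WithLp.toLp 2 z‖) :=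
      Continuous.tendsto (by fun_prop) 0
    rw [zero_smul, norm_zero] at this
    exact this.eventually_lt_const one_pos
  filter_upwards [ev] with t ht
  have h1 := hasSum_taylorTerm hcomm hreg hid h ⟨t • WithLp.toLp 2 z, mem_ball_zero_iff.2 ht⟩ x
  rw [hx] at h1
  have h2 : lincomb (colL T) (t • WithLp.toLp 2 z : EuclideanSpace ℂ (Fin n)).ofLp =
      t • lincomb (colL T) z := by
    simp [lincomb, Finset.smul_sum, smul_smul]
  refine h1.congr_fun fun k => ?_
  change _ = wanderingProj T ((lincomb (colL T) _ ^ k) x)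
  rw [h2, smul_pow, smul_apply, map_smul]
  rfl

end Evaluation

/-! ### From the kernel identity to a unitary -/

section Kernel

/-- The families `F(x)^* v` and the kernel functions have the same Gram matrix and are both total,
the first because the `F(x)` are jointly injective; matching them extends to a unitary. -/
theorem exists_linearIsometryEquiv_ofKernel {X V H : Type*} [NormedAddCommGroup V]
    [InnerProductSpace ℂ V] [CompleteSpace V] [NormedAddCommGroup H] [InnerProductSpace ℂ H]
    [CompleteSpace H] (K : Matrix X X (V →L[ℂ] V)) [Fact K.PosSemidef] (F : X → H →L[ℂ] V)
    (hK : ∀ x y v, F x (adjoint (F y) v) = K x y v) (hF : ∀ h, (∀ x, F x h = 0) → h = 0) :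
    ∃ U : H ≃ₗᵢ[ℂ] RKHS.OfKernel K, ∀ h x, U h x = F x h := by
  let e₁ : (X × V →₀ ℂ) →ₗ[ℂ] H :=
    Finsupp.linearCombination ℂ fun p => adjoint (F p.1) p.2
  let e₂ : (X × V →₀ ℂ) →ₗ[ℂ] RKHS.OfKernel K :=
    Finsupp.linearCombination ℂ fun p => RKHS.kerFun (RKHS.OfKernel K) p.1 p.2
  have hnorm : ∀ f, ‖e₂ (LinearEquiv.refl ℂ _ f)‖ = ‖e₁ f‖ := fun f => by
    have h1 : (inner ℂ (e₂ f) (e₂ f) : ℂ) = inner ℂ (e₁ f) (e₁ f) := by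
      simp only [e₁, e₂, Finsupp.linearCombination_apply, Finsupp.sum_inner, Finsupp.inner_sum,
        inner_smul_left, inner_smul_right]
      refine Finsupp.sum_congr fun p _ => ?_
      refine congrArg _ (Finsupp.sum_congr fun q _ => ?_)
      rw [adjoint_inner_left, hK, RKHS.kerFun_inner, RKHS.kerFun_apply,
        RKHS.OfKernel.kernel_ofKernel]
    have h2 := congrArg Complex.re h1
    rw [re_inner_self, re_inner_self] at h2
    exact (pow_left_inj₀ (norm_nonneg _) (norm_nonneg _) two_ne_zero).1 h2
  have hd₁ : DenseRange e₁ := by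
    have h1 : (LinearMap.range e₁).topologicalClosure = ⊤ := by
      rw [Submodule.topologicalClosure_eq_top_iff, Submodule.eq_bot_iff]
      intro h hh
      refine hF h fun x => ext_inner_left ℂ fun v => ?_
      rw [← adjoint_inner_left, inner_zero_right]
      refine hh _ ⟨Finsupp.single (x, v) 1, ?_⟩
      simp [e₁]
    exact (Submodule.dense_iff_topologicalClosure_eq_top).2 h1
  have hd₂ : DenseRange e₂ := by
    have h1 : (LinearMap.range e₂).topologicalClosure = ⊤ := by
      rw [Submodule.topologicalClosure_eq_top_iff, Submodule.eq_bot_iff]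
      intro f hf
      refine RKHS.ext fun x => ext_inner_left ℂ fun v => ?_
      rw [RKHS.coe_zero, Pi.zero_apply, inner_zero_right, ← RKHS.kerFun_inner]
      refine hf _ ⟨Finsupp.single (x, v) 1, ?_⟩
      simp [e₂]
    exact (Submodule.dense_iff_topologicalClosure_eq_top).2 h1
  let U := (LinearEquiv.refl ℂ (X × V →₀ ℂ)).extendOfIsometry e₁ e₂ hd₁ hd₂ hnorm
  have hU : ∀ x v, U (adjoint (F x) v) = RKHS.kerFun (RKHS.OfKernel K) x v := fun x v => by
    have h1 : e₁ (Finsupp.single (x, v) 1) = adjoint (F x) v := by simp [e₁]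
    have h2 : e₂ (Finsupp.single (x, v) 1) = RKHS.kerFun (RKHS.OfKernel K) x v := by simp [e₂]
    rw [← h1, ← h2]
    exact LinearEquiv.extendOfIsometry_eq _ _ _ _ _ _ _
  refine ⟨U, fun h x => ext_inner_left ℂ fun v => ?_⟩
  rw [← RKHS.kerFun_inner, ← hU, LinearIsometryEquiv.inner_map_map, adjoint_inner_left]

theorem exists_linearIsometryEquiv_besovSpace {n m : ℕ} {H : Type*} [NormedAddCommGroup H]
    [InnerProductSpace ℂ H] [CompleteSpace H] {T : Fin n → H →L[ℂ] H}
    (hcomm : ∀ i j, T i * T j = T j * T i) (hreg : IsRegularAtZero T)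
    (hid : SatisfiesIdentity (m + 1) T) (h : IsTypeCDotZero T) :
    ∃ U : H ≃ₗᵢ[ℂ] BesovSpace n (m + 1) (wandering T), ∀ x z, U x z = evalOp T z x :=
  exists_linearIsometryEquiv_ofKernel _ (evalOp T) (evalOp_adjoint_evalOp hcomm hreg hid h)
    fun _ => eq_zero_of_evalOp_eq_zero hcomm hreg hid h

end Kernel

/-! ### The coordinate multipliers are of type `C_{·0}` -/

section CoordMul

variable {n : ℕ} {H : Type*} [NormedAddCommGroup H] [InnerProductSpace ℂ H] [CompleteSpace H]

theorem inner_sigma (T : Fin n → H →L[ℂ] H) (X : H →L[ℂ] H) (x y : H) :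
    inner ℂ (sigma T X x) y = ∑ i, inner ℂ (X (adjoint (T i) x)) (adjoint (T i) y) := by
  rw [sigma_apply, sum_inner]
  simp only [adjoint_inner_right]

theorem sigmaMoment_succ (T : Fin n → H →L[ℂ] H) (x : H) (N : ℕ) :
    sigmaMoment T x (N + 1) = ∑ i, sigmaMoment T (adjoint (T i) x) N := by
  simp only [sigmaMoment, Function.iterate_succ_apply']
  rw [inner_sigma, Complex.re_sum]

theorem sigmaMoment_le {T : Fin n → H →L[ℂ] H} (h : ∀ x, sigmaMoment T x 1 ≤ ‖x‖ ^ 2) (N : ℕ)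
    (x : H) : sigmaMoment T x N ≤ ‖x‖ ^ 2 := by
  induction N generalizing x with
  | zero => exact (sigmaMoment_zero x).le
  | succ N ih =>
    rw [sigmaMoment_succ]
    refine (Finset.sum_le_sum fun i _ => ih _).trans ?_
    simp only [← sigmaMoment_zero (T := T)]
    rw [← sigmaMoment_succ, sigmaMoment_zero]
    exact h x

theorem UnitarilyEquivalent.isTypeCDotZero {K : Type*} [NormedAddCommGroup K]
    [InnerProductSpace ℂ K] [CompleteSpace K] {T : Fin n → H →L[ℂ] H} {S : Fin n → K →L[ℂ] K}
    (hTS : UnitarilyEquivalent T S) (hS : IsTypeCDotZero S) : IsTypeCDotZero T := by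
  obtain ⟨U, hU⟩ := hTS
  have hadj : ∀ i x, U (adjoint (T i) x) = adjoint (S i) (U x) := fun i x => by
    refine ext_inner_right ℂ fun y => ?_
    obtain ⟨y, rfl⟩ := U.surjective y
    rw [LinearIsometryEquiv.inner_map_map, adjoint_inner_left, adjoint_inner_left, ← hU,
      LinearIsometryEquiv.inner_map_map]
  have hσ : ∀ k x, U ((sigma T)^[k] 1 x) = (sigma S)^[k] 1 (U x) := fun k => by
    induction k with
    | zero => intro x; rfl
    | succ k ih =>
      intro x
      rw [Function.iterate_succ_apply', Function.iterate_succ_apply', sigma_apply, sigma_apply,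
        map_sum]
      simp only [hU, ih, hadj]
  intro x
  have h1 := (U.symm.continuous.tendsto 0).comp (hS (U x))
  rw [map_zero] at h1
  refine h1.congr fun k => ?_
  rw [Function.comp_apply, ← hσ, LinearIsometryEquiv.symm_apply_apply]

variable {m : ℕ} {D : Type*} [NormedAddCommGroup D] [InnerProductSpace ℂ D] [CompleteSpace D]

theorem IsCoordMul.adjoint_kerFun {M : Fin n → BesovSpace n m D →L[ℂ] BesovSpace n m D}
    (hM : IsCoordMul M) (i : Fin n) (z : Ball n) (v : D) :
    adjoint (M i) (RKHS.kerFun (BesovSpace n m D) z v) =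
      star (z.1 i) • RKHS.kerFun (BesovSpace n m D) z v := by
  refine ext_inner_right ℂ fun f => ?_
  rw [adjoint_inner_left, inner_smul_left, RKHS.kerFun_inner, RKHS.kerFun_inner, hM,
    inner_smul_right]
  simp

theorem inner_kerFun_kerFun (x y : Ball n) (v w : D) :
    inner ℂ (RKHS.kerFun (BesovSpace n m D) x v) (RKHS.kerFun (BesovSpace n m D) y w) =
      ((1 - inner ℂ y.1 x.1) ^ m)⁻¹ * inner ℂ v w := by
  rw [← RKHS.kernel_inner, RKHS.OfKernel.kernel_ofKernel]
  simp [besovKernel, inner_smul_left]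

/-- For a finite combination `g` of kernel functions, `‖g‖² - ∑ ‖M_i^* g‖²` is the quadratic form of
the kernel with exponent `m` instead of `m + 1`, which is positive; such `g` are dense. -/
theorem IsCoordMul.sigmaMoment_one_le
    {M : Fin n → BesovSpace n (m + 1) D →L[ℂ] BesovSpace n (m + 1) D} (hM : IsCoordMul M)
    (f : BesovSpace n (m + 1) D) : sigmaMoment M f 1 ≤ ‖f‖ ^ 2 := by
  let k := fun x : Ball n => RKHS.kerFun (BesovSpace n (m + 1) D) x
  have hfin : ∀ vv : Ball n →₀ D,
      sigmaMoment M (vv.sum fun x v => k x v) 1 ≤ ‖vv.sum fun x v => k x v‖ ^ 2 := by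
    intro vv
    set g := vv.sum fun x v => k x v with hg
    have h1 : ∀ i, adjoint (M i) g = vv.sum fun x v => star (x.1 i) • k x v := fun i => by
      rw [hg, map_finsuppSum]
      exact Finsupp.sum_congr fun x _ => hM.adjoint_kerFun i x _
    have h2 : inner ℂ g g - ∑ i, inner ℂ (adjoint (M i) g) (adjoint (M i) g) =
        vv.sum fun x w => vv.sum fun x' w' => inner ℂ ((besovKernel n m D x' x) w) w' := by
      simp only [h1]
      rw [hg]
      simp only [Finsupp.sum, sum_inner, inner_smul_left]
      simp only [inner_sum, inner_smul_right, Finset.mul_sum]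
      rw [Finset.sum_comm (s := Finset.univ), ← Finset.sum_sub_distrib]
      refine Finset.sum_congr rfl fun x _ => ?_
      rw [Finset.sum_comm (s := Finset.univ), ← Finset.sum_sub_distrib]
      refine Finset.sum_congr rfl fun x' _ => ?_
      have h3 : (1 - inner ℂ x'.1 x.1 : ℂ) ≠ 0 := fun h0 => by
        have := inner_lt_one n x' x
        rw [← sub_eq_zero.1 h0, norm_one] at this
        exact lt_irrefl _ this
      have h4 : inner ℂ (besovKernel n m D x' x (vv x)) (vv x') =
          (1 - inner ℂ x'.1 x.1) * inner ℂ (k x (vv x)) (k x' (vv x')) := by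
        rw [inner_kerFun_kerFun, pow_succ]
        simp only [besovKernel, Matrix.of_apply, smul_apply, inner_smul_left]
        field_simp
        simp
        rw [mul_comm, mul_inv_cancel_left₀ (pow_ne_zero _ h3)]
      rw [h4, sub_mul, one_mul, PiLp.inner_apply, Finset.sum_mul]
      congr 1
      refine Finset.sum_congr rfl fun i _ => ?_
      simp; ring
    have ht := (RKHS.posSemidef_tfae (K := besovKernel n m D)).out 0 2
    have h5 := (ht.1 (posSemidef_besovKernel n m D)).2 vv
    rw [← h2] at h5
    have h6 : 0 ≤ (inner ℂ g g : ℂ).re -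
        ∑ i, (inner ℂ (adjoint (M i) g) (adjoint (M i) g) : ℂ).re := by
      rw [← Complex.re_sum, ← Complex.sub_re]
      exact h5
    rw [sigmaMoment_succ]
    simp only [sigmaMoment_zero]
    simp only [re_inner_self] at h6
    linarith
  have hspan : ∀ g ∈ Submodule.span ℂ {RKHS.kerFun (BesovSpace n (m + 1) D) x v | (x) (v)},
      ∃ vv : Ball n →₀ D, g = vv.sum fun x v => k x v := by
    intro g hg
    classical
    induction hg using Submodule.span_induction with
    | mem g hg =>
      obtain ⟨x, v, rfl⟩ := hg
      exact ⟨Finsupp.single x v, by simp [k]⟩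
    | zero => exact ⟨0, by simp⟩
    | add g g' _ _ h h' =>
      obtain ⟨vv, rfl⟩ := h
      obtain ⟨vv', rfl⟩ := h'
      exact ⟨vv + vv', (Finsupp.sum_add_index' (by simp) (by simp)).symm⟩
    | smul a g _ h =>
      obtain ⟨vv, rfl⟩ := h
      refine ⟨a • vv, ?_⟩
      rw [Finsupp.sum_smul_index' (by simp), Finsupp.smul_sum]
      simp
  have hcl : IsClosed {f | sigmaMoment M f 1 ≤ ‖f‖ ^ 2} := by
    refine isClosed_le ?_ (by fun_prop)
    unfold sigmaMoment
    fun_prop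
  have hf : f ∈ closure (Submodule.span ℂ
      {RKHS.kerFun (BesovSpace n (m + 1) D) x v | (x) (v)} : Set (BesovSpace n (m + 1) D)) := by
    rw [← Submodule.topologicalClosure_coe, RKHS.kerFun_dense]; trivial
  refine hcl.closure_subset_iff.2 (fun g hg => ?_) hf
  obtain ⟨vv, rfl⟩ := hspan g hg
  exact hfin vv

theorem IsCoordMul.isTypeCDotZero
    {M : Fin n → BesovSpace n (m + 1) D →L[ℂ] BesovSpace n (m + 1) D} (hM : IsCoordMul M) :
    IsTypeCDotZero M := by
  have hle := sigmaMoment_le hM.sigmaMoment_one_le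
  refine isTypeCDotZero_of_dense hle (RKHS.kerFun_dense (BesovSpace n (m + 1) D)) ?_
  rintro _ ⟨z, v, rfl⟩
  set g := RKHS.kerFun (BesovSpace n (m + 1) D) z v with hg
  have h2 : ∀ a : ℂ, (starRingEnd ℂ) (star a) * star a = ((‖a‖ ^ 2 : ℝ) : ℂ) := fun a => by
    rw [Complex.ofReal_pow, ← Complex.mul_conj']
    simp
  -- Kernel functions are joint eigenvectors of the `M_i^*`, so each `σ_M` contributes a factor
  -- `‖z‖² < 1`.
  have h1 : ∀ N, sigmaMoment M g N = (‖z.1‖ ^ 2) ^ N * ‖g‖ ^ 2 := fun N => by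
    induction N with
    | zero => rw [sigmaMoment_zero, pow_zero, one_mul]
    | succ N ih =>
      rw [sigmaMoment_succ, pow_succ', mul_assoc, ← ih, EuclideanSpace.norm_sq_eq, Finset.sum_mul]
      refine Finset.sum_congr rfl fun i _ => ?_
      rw [hM.adjoint_kerFun, sigmaMoment, map_smul, inner_smul_left, inner_smul_right, ← mul_assoc,
        h2, Complex.re_ofReal_mul]
      rfl
  have hz : ‖z.1‖ ^ 2 < 1 := pow_lt_one₀ (norm_nonneg _) (mem_ball_zero_iff.1 z.2) two_ne_zero
  have h2 : Tendsto (fun N => ‖((sigma M)^[N] 1) g‖ ^ 2) atTop (𝓝 0) := by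
    refine squeeze_zero (fun N => sq_nonneg _) (fun N => (norm_sq_le_of_isPositive
      (isPositive_sigma_iterate M isPositive_one N) (fun f => hle N f) g).trans_eq (h1 N)) ?_
    simpa using (tendsto_pow_atTop_nhds_zero_of_lt_one (sq_nonneg _) hz).mul_const (‖g‖ ^ 2)
  have h3 : Tendsto (fun N => ‖((sigma M)^[N] 1) g‖) atTop (𝓝 0) := by
    simpa using h2.sqrt
  exact tendsto_zero_iff_norm_tendsto_zero.2 h3

end CoordMul

/-! ### The implications between the four conditions -/

section Equivalences

variable {n m : ℕ} {H : Type*} [NormedAddCommGroup H] [InnerProductSpace ℂ H] [CompleteSpace H]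
variable {T : Fin n → H →L[ℂ] H}

theorem IsTypeCDotZero.exists_hasPowerSeries (hcomm : ∀ i j, T i * T j = T j * T i)
    (hreg : IsRegularAtZero T) (hid : SatisfiesIdentity (m + 1) T) (h : IsTypeCDotZero T) (x : H) :
    ∃ f : BesovSpace n (m + 1) (wandering T),
      HasPowerSeries f (fun α => (Nat.multinomial Finset.univ α : ℂ) •
        (wandering T).orthogonalProjectionOnto (mpow (colL T) α x)) ∧ ‖x‖ ^ 2 = ‖f‖ ^ 2 := by
  obtain ⟨U, hU⟩ := exists_linearIsometryEquiv_besovSpace hcomm hreg hid h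
  refine ⟨U x, fun z => ?_, by rw [LinearIsometryEquiv.norm_map]⟩
  rw [hU]
  exact hasSum_evalOp hcomm hreg hid h z x

theorem IsTypeCDotZero.exists_unitarilyEquivalent (hcomm : ∀ i j, T i * T j = T j * T i)
    (hreg : IsRegularAtZero T) (hid : SatisfiesIdentity (m + 1) T) (h : IsTypeCDotZero T) :
    ∃ M : Fin n → BesovSpace n (m + 1) (wandering T) →L[ℂ] BesovSpace n (m + 1) (wandering T),
      IsCoordMul M ∧ UnitarilyEquivalent T M := by
  obtain ⟨U, hU⟩ := exists_linearIsometryEquiv_besovSpace hcomm hreg hid h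
  refine ⟨fun i => (U.toContinuousLinearEquiv : H →L[ℂ] _) ∘L T i ∘L
    (U.symm.toContinuousLinearEquiv : _ →L[ℂ] H), fun i f z => ?_, U, fun i x => ?_⟩
  · change U (T i (U.symm f)) z = _
    rw [hU, evalOp_row hcomm hreg hid h, ← hU, LinearIsometryEquiv.apply_symm_apply]
  · change _ = U (T i (U.symm (U x)))
    rw [LinearIsometryEquiv.symm_apply_apply]

/-- If all Taylor terms of `x` vanish, its power series is the zero function, and the norm identity
forces `x = 0`. -/
theorem isAnalytic_of_exists_hasPowerSeries (hcomm : ∀ i j, T i * T j = T j * T i)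
    (hreg : IsRegularAtZero T) (hid : SatisfiesIdentity m T)
    (h : ∀ x : H, ∃ f : BesovSpace n m (wandering T),
      HasPowerSeries f (fun α => (Nat.multinomial Finset.univ α : ℂ) •
        (wandering T).orthogonalProjectionOnto (mpow (colL T) α x)) ∧ ‖x‖ ^ 2 = ‖f‖ ^ 2) :
    IsAnalytic T := by
  refine (isAnalytic_iff hcomm hreg hid).2 fun x hx => ?_
  obtain ⟨f, hf, hnorm⟩ := h x
  have hf0 : f = 0 := RKHS.ext fun z => by
    refine (hf z).unique ?_
    rw [RKHS.coe_zero, Pi.zero_apply]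
    convert hasSum_zero with α
    exact (congrArg _ (taylorCoef_eq_zero hcomm hid hx α)).trans (smul_zero _)
  rw [hf0, norm_zero] at hnorm
  simpa using hnorm

end Equivalences

end BergmanShift

end

theorem mainTheorem4 {n m : ℕ} (hm : 1 ≤ m) {H : Type u} [NormedAddCommGroup H]
    [InnerProductSpace ℂ H] [CompleteSpace H] (T : Fin n → H →L[ℂ] H)
    (hcomm : ∀ i j, T i * T j = T j * T i)
    (hreg : BergmanShift.IsRegularAtZero T)
    (hid : BergmanShift.SatisfiesIdentity m T) :
    List.TFAE
      [BergmanShift.IsAnalytic T,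
       ∀ x : H, ∃ f : BergmanShift.BesovSpace n m (BergmanShift.wandering T),
         BergmanShift.HasPowerSeries f (fun α => (Nat.multinomial Finset.univ α : ℂ) •
           (BergmanShift.wandering T).orthogonalProjectionOnto
             (BergmanShift.mpow (BergmanShift.colL T) α x)) ∧
         ‖x‖ ^ 2 = ‖f‖ ^ 2,
       BergmanShift.IsTypeCDotZero T,
       ∃ (D : Type u) (_ : NormedAddCommGroup D) (_ : InnerProductSpace ℂ D)
         (_ : CompleteSpace D)
         (M : Fin n → BergmanShift.BesovSpace n m D →L[ℂ] BergmanShift.BesovSpace n m D),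
         BergmanShift.IsCoordMul M ∧ BergmanShift.UnitarilyEquivalent T M] := by
  obtain ⟨m, rfl⟩ := Nat.exists_eq_add_of_le' hm
  tfae_have 1 → 3 := fun h => h.isTypeCDotZero hm hcomm hreg hid
  tfae_have 3 → 2 := fun h x => h.exists_hasPowerSeries hcomm hreg hid x
  tfae_have 2 → 1 := BergmanShift.isAnalytic_of_exists_hasPowerSeries hcomm hreg hid
  tfae_have 3 → 4 := fun h => ⟨BergmanShift.wandering T, inferInstance, inferInstance,
    inferInstance, h.exists_unitarilyEquivalent hcomm hreg hid⟩
  tfae_have 4 → 3 := by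
    rintro ⟨D, _, _, _, M, hM, hTM⟩
    exact hTM.isTypeCDotZero hM.isTypeCDotZero
  tfae_finish
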